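/- **Proposition (the 2-skeleton is dagger compact).** Let $\mathscr B$ be a bicategory that is *composition-closed* (it has all right extensions and all right lifts) and *compact-closed* (it is a symmetric monoidal bicategory, with tensor pseudofunctor $\otimes$, unit $I$, associator $a$, unitors $l,r$ and braid $b$, in which every object $A$ has a chosen dual $A^*$ with 1-cells $\mathrm{coev}_A\colon I\to A\otimes A^*$ and $\mathrm{ev}_A\colon A^*\otimes A\to I$ satisfying the two zigzag identities up to invertible 2-cells). Call $g\colon B\to A$ an *ambi-adjoint* of $f\colon A\to B$ if $g$ is both a left and a right adjoint of $f$. Suppose that * every 1-cell $f$ of $\mathscr B$ has an ambi-adjoint $f^\vee$ (which is then unique up to an invertible 2-cell), and * for every object $A$, $\mathrm{coev}_A$ is an ambi-adjoint of $\mathrm{ev}_A\circ b_{A,A^*}\colon A\otimes A^*\to I$. Let $\mathscr B_0$ be the *2-skeleton* of $\mathscr B$: the category with the objects of $\mathscr B$, whose morphisms are the isomorphism classes $[f]$ of 1-cells. Then the operations induced from $\mathscr B$, namely $[f]\otimes[g]=[f\otimes g]$, the unit $I$, the associator $[a]$, the unitors $[l],[r]$, the braid $[b]$, the duals $A^*$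 with $[\mathrm{coev}_A]$ and $[\mathrm{ev}_A]$, and the dagger $[f]^\dagger=[f^\vee]$, make $\mathscr B_0$ a *dagger compact category*. That is, $\mathscr B_0$ is a symmetric monoidal category in which $A^*$ is dual to $A$; $(-)^\dagger$ is an identity-on-objects involutive contravariant functor with $(f\otimes g)^\dagger=f^\dagger\otimes g^\dagger$, for which the associator, unitors and braid are unitary; and $b_{A^*,A}\circ \mathrm{ev}_A^\dagger=\mathrm{coev}_A$ for every $A$. Not all dagger compact categories arise in this way. Let $\mathrm{FDHilb}$ be the category of finite-dimensional complex Hilbert spaces and linear maps, with $T^\dagger$ the adjoint of $T$. There is no composition-closed bicategory $\mathscr B$ in which every 1-cell has an ambi-adjoint, together with an equivalence of categories $F\colon\mathrm{FDHilb}\to\mathscr B_0$, such that $F(T^\dagger)=F(T)^\dagger$ for all $T$, where $[f]^\dagger=[f^\vee]$ in $\mathscr B_0$. -/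

import Mathlib

open CategoryTheory Bicategory
open scoped Pseudofunctor.StrongTrans
open scoped CategoryTheory.Prod

universe s w v u w₁ v₁ u₁ w₂ v₂ u₂ w₃ v₃ u₃

namespace CompactBicat

section Pseudo
variable {E : Type u₁} [Bicategory.{w₁, v₁} E] {C : Type u₂} [Bicategory.{w₂, v₂} C]
  {D : Type u₃} [Bicategory.{w₃, v₃} D]

/-- The pseudofunctor `X ↦ (F X, G X)`. -/
@[simps]
def pair (F : E ⥤ᵖ C) (G : E ⥤ᵖ D) : E ⥤ᵖ C × D where
  obj X := (F.obj X, G.obj X)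
  map f := F.map f ×ₘ G.map f
  map₂ φ := F.map₂ φ ×ₘ G.map₂ φ
  mapId X := Iso.prod (F.mapId X) (G.mapId X)
  mapComp f g := Iso.prod (F.mapComp f g) (G.mapComp f g)

/-- The constant pseudofunctor at `c`. -/
@[simps]
def constant (E : Type u₁) [Bicategory.{w₁, v₁} E] (c : C) : E ⥤ᵖ C where
  obj _ := c
  map _ := 𝟙 c
  map₂ _ := 𝟙 (𝟙 c)
  mapId _ := Iso.refl (𝟙 c)
  mapComp _ _ := (λ_ (𝟙 c)).symm

/-- Componentwise pairing of pseudonatural transformations. -/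
def pairTrans {F F' : E ⥤ᵖ C} {G G' : E ⥤ᵖ D} (η : F ⟶ F') (θ : G ⟶ G') :
    pair F G ⟶ pair F' G' where
  app X := η.app X ×ₘ θ.app X
  naturality f := Iso.prod (η.naturality f) (θ.naturality f)
  naturality_naturality φ :=
    Prod.ext (η.naturality_naturality φ) (θ.naturality_naturality φ)
  naturality_id X := Prod.ext (η.naturality_id X) (θ.naturality_id X)
  naturality_comp f g := Prod.ext (η.naturality_comp f g) (θ.naturality_comp f g)

theorem map₂_rightUnitor_inv_aux (H : C ⥤ᵖ D) {a b : C} (f : a ⟶ b) :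
    H.map₂ (ρ_ f).inv ≫ (H.mapComp f (𝟙 b)).hom ≫ H.map f ◁ (H.mapId b).hom =
      (ρ_ (H.map f)).inv := by
  rw [← cancel_epi (H.map₂ (ρ_ f).hom), ← H.map₂_comp_assoc]
  simp

theorem map₂_associator_inv_aux (H : C ⥤ᵖ D) {a b c d : C} (f : a ⟶ b) (g : b ⟶ c)
    (h : c ⟶ d) :
    H.map₂ (α_ f g h).inv = (H.mapComp f (g ≫ h)).hom ≫ H.map f ◁ (H.mapComp g h).hom ≫
      (α_ (H.map f) (H.map g) (H.map h)).inv ≫ (H.mapComp f g).inv ▷ H.map h ≫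
      (H.mapComp (f ≫ g) h).inv := by
  rw [← cancel_epi (H.map₂ (α_ f g h).hom), ← H.map₂_comp]
  simp

theorem postWhisker_naturality_aux {F G : E ⥤ᵖ C} (η : F ⟶ G) (H : C ⥤ᵖ D)
    {X Y : E} {f g : X ⟶ Y} (φ : f ⟶ g) :
    H.map₂ (F.map₂ φ) ▷ H.map (η.app Y) ≫ (H.mapComp _ _).inv ≫
      H.map₂ (η.naturality g).hom ≫ (H.mapComp _ _).hom =
    ((H.mapComp _ _).inv ≫ H.map₂ (η.naturality f).hom ≫ (H.mapComp _ _).hom) ≫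
      H.map (η.app X) ◁ H.map₂ (G.map₂ φ) := by
  have h := congrArg H.map₂ (η.naturality_naturality φ)
  simp only [H.map₂_comp, H.map₂_whisker_right, H.map₂_whisker_left] at h
  have h2 := (H.mapComp _ _).inv ≫= h =≫ (H.mapComp _ _).hom
  simpa using h2

theorem postWhisker_id_aux {F G : E ⥤ᵖ C} (η : F ⟶ G) (H : C ⥤ᵖ D) (X : E) :
    ((H.mapComp _ _).inv ≫ H.map₂ (η.naturality (𝟙 X)).hom ≫ (H.mapComp _ _).hom) ≫
      H.map (η.app X) ◁ (H.map₂ (G.mapId X).hom ≫ (H.mapId (G.obj X)).hom) =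
    (H.map₂ (F.mapId X).hom ≫ (H.mapId (F.obj X)).hom) ▷ H.map (η.app X) ≫
      (λ_ (H.map (η.app X))).hom ≫ (ρ_ (H.map (η.app X))).inv := by
  have h := congrArg H.map₂ (η.naturality_id X)
  simp only [H.map₂_comp, H.map₂_whisker_right, H.map₂_whisker_left, H.map₂_left_unitor] at h
  have h2 := (H.mapComp _ _).inv ≫= h =≫ (H.mapComp _ _).hom
  have h3 := h2 =≫ H.map (η.app X) ◁ (H.mapId _).hom
  simp only [Category.assoc, Iso.inv_hom_id_assoc, Iso.inv_hom_id, Category.comp_id,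
    map₂_rightUnitor_inv_aux, whiskerLeft_comp, comp_whiskerRight] at h3 ⊢
  exact h3

theorem postWhisker_comp_aux {F G : E ⥤ᵖ C} (η : F ⟶ G) (H : C ⥤ᵖ D) {X Y Z : E}
    (f : X ⟶ Y) (g : Y ⟶ Z) :
    ((H.mapComp _ _).inv ≫ H.map₂ (η.naturality (f ≫ g)).hom ≫ (H.mapComp _ _).hom) ≫
      H.map (η.app X) ◁ (H.map₂ (G.mapComp f g).hom ≫ (H.mapComp _ _).hom) =
    (H.map₂ (F.mapComp f g).hom ≫ (H.mapComp _ _).hom) ▷ H.map (η.app Z) ≫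
      (α_ _ _ _).hom ≫
      H.map (F.map f) ◁ ((H.mapComp _ _).inv ≫ H.map₂ (η.naturality g).hom ≫
        (H.mapComp _ _).hom) ≫ (α_ _ _ _).inv ≫
      ((H.mapComp _ _).inv ≫ H.map₂ (η.naturality f).hom ≫ (H.mapComp _ _).hom) ▷
        H.map (G.map g) ≫ (α_ _ _ _).hom := by
  have h := congrArg H.map₂ (η.naturality_comp f g)
  simp only [H.map₂_comp, H.map₂_whisker_right, H.map₂_whisker_left, H.map₂_associator,
    map₂_associator_inv_aux] at h
  have h2 := (H.mapComp _ _).inv ≫= h =≫ (H.mapComp _ _).hom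
  have h3 := h2 =≫ H.map (η.app X) ◁ (H.mapComp _ _).hom
  simp only [Category.assoc, Iso.inv_hom_id_assoc, Iso.inv_hom_id,
    whiskerLeft_inv_hom, Category.comp_id,
    whiskerLeft_comp, comp_whiskerRight] at h3 ⊢
  exact h3

/-- Whiskering of a pseudonatural transformation with a pseudofunctor applied afterwards. -/
def postWhisker {F G : E ⥤ᵖ C} (η : F ⟶ G) (H : C ⥤ᵖ D) : F.comp H ⟶ G.comp H where
  app X := H.map (η.app X)
  naturality f := (H.mapComp _ _).symm ≪≫ H.map₂Iso (η.naturality f) ≪≫ H.mapComp _ _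
  naturality_naturality φ := postWhisker_naturality_aux η H φ
  naturality_id X := postWhisker_id_aux η H X
  naturality_comp f g := postWhisker_comp_aux η H f g

/-- Restriction of a pseudonatural transformation along a pseudofunctor. -/
def preWhisker (P : E ⥤ᵖ C) {F G : C ⥤ᵖ D} (η : F ⟶ G) : P.comp F ⟶ P.comp G where
  app X := η.app (P.obj X)
  naturality f := η.naturality (P.map f)
  naturality_naturality φ := η.naturality_naturality (P.map₂ φ)
  naturality_id X := by
    have h := η.naturality_naturality (P.mapId X).hom
    have h' := η.naturality_id (P.obj X)
    have e : (η.naturality (P.map (𝟙 X))).hom ≫ η.app (P.obj X) ◁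
          (G.map₂ (P.mapId X).hom ≫ (G.mapId _).hom) =
        (F.map₂ (P.mapId X).hom ≫ (F.mapId _).hom) ▷ η.app (P.obj X) ≫
          (λ_ _).hom ≫ (ρ_ _).inv := by
      rw [whiskerLeft_comp, ← reassoc_of% h, h', comp_whiskerRight, Category.assoc]
    exact e
  naturality_comp f g := by
    have h := η.naturality_naturality (P.mapComp f g).hom
    have h' := η.naturality_comp (P.map f) (P.map g)
    have e : (η.naturality (P.map (f ≫ g))).hom ≫ η.app _ ◁
          (G.map₂ (P.mapComp f g).hom ≫ (G.mapComp _ _).hom) =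
        (F.map₂ (P.mapComp f g).hom ≫ (F.mapComp _ _).hom) ▷ η.app _ ≫ (α_ _ _ _).hom ≫
          F.map (P.map f) ◁ (η.naturality (P.map g)).hom ≫ (α_ _ _ _).inv ≫
          (η.naturality (P.map f)).hom ▷ G.map (P.map g) ≫ (α_ _ _ _).hom := by
      rw [whiskerLeft_comp, ← reassoc_of% h, h', comp_whiskerRight, Category.assoc]
    exact e

theorem id_law {a b : D} {x : a ⟶ b} {m : a ⟶ a} {n : b ⟶ b} {p p' : m ⟶ 𝟙 a}
    {q q' : n ⟶ 𝟙 b} {ν : m ≫ x ⟶ x ≫ n}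
    (h : ν ≫ x ◁ q' = p' ▷ x ≫ (λ_ x).hom ≫ (ρ_ x).inv) (hp : p = p') (hq : q = q') :
    ν ≫ x ◁ q = p ▷ x ≫ (λ_ x).hom ≫ (ρ_ x).inv := by
  rw [hp, hq, h]

theorem comp_law {a b c a' b' c' : D} {x : a ⟶ a'} {y : b ⟶ b'} {z : c ⟶ c'}
    {k : a ⟶ c} {f : a ⟶ b} {g : b ⟶ c} {k' : a' ⟶ c'} {f' : a' ⟶ b'} {g' : b' ⟶ c'}
    {p p' : k ⟶ f ≫ g} {q q' : k' ⟶ f' ≫ g'} {ν : k ≫ z ⟶ x ≫ k'}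
    {νf : f ≫ y ⟶ x ≫ f'} {νg : g ≫ z ⟶ y ≫ g'}
    (h : ν ≫ x ◁ q' = p' ▷ z ≫ (α_ _ _ _).hom ≫ f ◁ νg ≫ (α_ _ _ _).inv ≫
      νf ▷ g' ≫ (α_ _ _ _).hom) (hp : p = p') (hq : q = q') :
    ν ≫ x ◁ q = p ▷ z ≫ (α_ _ _ _).hom ≫ f ◁ νg ≫ (α_ _ _ _).inv ≫
      νf ▷ g' ≫ (α_ _ _ _).hom := by
  rw [hp, hq, h]

variable (C)

/-- First projection of a product of two factors. -/
def pr₁ : C × C ⥤ᵖ C where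
  obj X := X.1
  map f := f.1
  map₂ φ := φ.1
  mapId _ := Iso.refl _
  mapComp _ _ := Iso.refl _

/-- Second projection of a product of two factors. -/
def pr₂ : C × C ⥤ᵖ C where
  obj X := X.2
  map f := f.2
  map₂ φ := φ.2
  mapId _ := Iso.refl _
  mapComp _ _ := Iso.refl _

/-- First projection of a product of three factors. -/
def tr₁ : C × C × C ⥤ᵖ C where
  obj X := X.1
  map f := f.1
  map₂ φ := φ.1
  mapId _ := Iso.refl _
  mapComp _ _ := Iso.refl _

/-- Second projection of a product of three factors. -/
def tr₂ : C × C × C ⥤ᵖ C where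
  obj X := X.2.1
  map f := f.2.1
  map₂ φ := φ.2.1
  mapId _ := Iso.refl _
  mapComp _ _ := Iso.refl _

/-- Third projection of a product of three factors. -/
def tr₃ : C × C × C ⥤ᵖ C where
  obj X := X.2.2
  map f := f.2.2
  map₂ φ := φ.2.2
  mapId _ := Iso.refl _
  mapComp _ _ := Iso.refl _

/-- First projection of a product of four factors. -/
def qr₁ : C × C × C × C ⥤ᵖ C where
  obj X := X.1
  map f := f.1
  map₂ φ := φ.1
  mapId _ := Iso.refl _
  mapComp _ _ := Iso.refl _

/-- Second projection of a product of four factors. -/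
def qr₂ : C × C × C × C ⥤ᵖ C where
  obj X := X.2.1
  map f := f.2.1
  map₂ φ := φ.2.1
  mapId _ := Iso.refl _
  mapComp _ _ := Iso.refl _

/-- Third projection of a product of four factors. -/
def qr₃ : C × C × C × C ⥤ᵖ C where
  obj X := X.2.2.1
  map f := f.2.2.1
  map₂ φ := φ.2.2.1
  mapId _ := Iso.refl _
  mapComp _ _ := Iso.refl _

/-- Fourth projection of a product of four factors. -/
def qr₄ : C × C × C × C ⥤ᵖ C where
  obj X := X.2.2.2
  map f := f.2.2.2
  map₂ φ := φ.2.2.2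
  mapId _ := Iso.refl _
  mapComp _ _ := Iso.refl _

end Pseudo

/-- The pseudofunctor `X ↦ F X ⊗ G X` for a given tensor pseudofunctor `t`. -/
abbrev tens {B : Type u} [Bicategory.{w, v} B] (t : B × B ⥤ᵖ B) {E : Type u₁}
    [Bicategory.{w₁, v₁} E] (F G : E ⥤ᵖ B) : E ⥤ᵖ B :=
  (pair F G).comp t

/-- A bicategory with a tensor product pseudofunctor, a unit, and pseudonatural adjoint
equivalences `(a ⊗ b) ⊗ c ≌ a ⊗ (b ⊗ c)`, `I ⊗ a ≌ a` and `a ⊗ I ≌ a`. -/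
structure TensorBicategory (B : Type u) [Bicategory.{w, v} B] where
  tensor : B × B ⥤ᵖ B
  unit : B
  assoc : tens tensor (tens tensor (tr₁ B) (tr₂ B)) (tr₃ B) ≌
    tens tensor (tr₁ B) (tens tensor (tr₂ B) (tr₃ B))
  leftUnitor : tens tensor (constant B unit) (Pseudofunctor.id B) ≌ Pseudofunctor.id B
  rightUnitor : tens tensor (Pseudofunctor.id B) (constant B unit) ≌ Pseudofunctor.id B

namespace TensorBicategory
variable {B : Type u} [Bicategory.{w, v} B] (K : TensorBicategory B)
variable {E : Type u₁} [Bicategory.{w₁, v₁} E]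

/-- The pseudofunctor `X ↦ F X ⊗ G X`. -/
abbrev T (F G : E ⥤ᵖ B) : E ⥤ᵖ B := tens K.tensor F G

/-- The pseudonatural transformation with components `η X ⊗ θ X`. -/
def tensorTrans {F F' G G' : E ⥤ᵖ B} (η : F ⟶ F') (θ : G ⟶ G') : K.T F G ⟶ K.T F' G' :=
  postWhisker (pairTrans η θ) K.tensor

/-- The pseudofunctor `X ↦ I`. -/
abbrev one (E : Type u₁) [Bicategory.{w₁, v₁} E] : E ⥤ᵖ B := constant E K.unit

/-- The tensor product of objects. -/
abbrev ob (a b : B) : B := K.tensor.obj (a, b)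

/-- The tensor product of 1-cells. -/
abbrev ho {a a' b b' : B} (f : a ⟶ a') (g : b ⟶ b') : K.ob a b ⟶ K.ob a' b' :=
  K.tensor.map (Prod.mkHom f g)

/-- The tensor product of 2-cells. -/
abbrev ho₂ {a a' b b' : B} {f f' : a ⟶ a'} {g g' : b ⟶ b'} (φ : f ⟶ f') (ψ : g ⟶ g') :
    K.ho f g ⟶ K.ho f' g' :=
  K.tensor.map₂ (a := (a, b)) (b := (a', b')) (f := Prod.mkHom f g) (g := Prod.mkHom f' g')
    (Prod.mkHom φ ψ)

theorem ho₂_comp {a a' b b' : B} {f f' f'' : a ⟶ a'} {g g' g'' : b ⟶ b'} (φ : f ⟶ f')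
    (φ' : f' ⟶ f'') (ψ : g ⟶ g') (ψ' : g' ⟶ g'') :
    K.ho₂ (φ ≫ φ') (ψ ≫ ψ') = K.ho₂ φ ψ ≫ K.ho₂ φ' ψ' :=
  K.tensor.map₂_comp (a := (a, b)) (b := (a', b')) (f := Prod.mkHom f g)
    (g := Prod.mkHom f' g') (h := Prod.mkHom f'' g'') (Prod.mkHom φ ψ) (Prod.mkHom φ' ψ')

theorem ho₂_id {a a' b b' : B} (f : a ⟶ a') (g : b ⟶ b') :
    K.ho₂ (𝟙 f) (𝟙 g) = 𝟙 (K.ho f g) :=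
  K.tensor.map₂_id (Prod.mkHom f g)

/-- The tensor product preserves identity 1-cells. -/
abbrev hoId (a b : B) : K.ho (𝟙 a) (𝟙 b) ≅ 𝟙 (K.ob a b) := K.tensor.mapId (a, b)

/-- The tensor product preserves composition of 1-cells. -/
abbrev hoComp {a a' a'' b b' b'' : B} (f : a ⟶ a') (f' : a' ⟶ a'') (g : b ⟶ b')
    (g' : b' ⟶ b'') : K.ho (f ≫ f') (g ≫ g') ≅ K.ho f g ≫ K.ho f' g' :=
  K.tensor.mapComp (a := (a, b)) (b := (a', b')) (c := (a'', b'')) (Prod.mkHom f g)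
    (Prod.mkHom f' g')

theorem mapId_left (F G H : E ⥤ᵖ B) (X : E) :
    ((K.T (K.T F G) H).mapId X).hom =
      (((pair F (pair G H)).comp (K.T (K.T (tr₁ B) (tr₂ B)) (tr₃ B))).mapId X).hom := by
  change K.ho₂ (K.ho₂ (F.mapId X).hom (G.mapId X).hom ≫ (K.tensor.mapId _).hom)
      (H.mapId X).hom ≫ (K.tensor.mapId _).hom =
    K.ho₂ (K.ho₂ (F.mapId X).hom (G.mapId X).hom) (H.mapId X).hom ≫
      K.ho₂ (K.ho₂ (𝟙 _) (𝟙 _) ≫ (K.tensor.mapId _).hom) (𝟙 _) ≫ (K.tensor.mapId _).hom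
  rw [ho₂_id, Category.id_comp, ← Category.assoc, ← ho₂_comp, Category.comp_id]

theorem mapId_right (F G H : E ⥤ᵖ B) (X : E) :
    ((K.T F (K.T G H)).mapId X).hom =
      (((pair F (pair G H)).comp (K.T (tr₁ B) (K.T (tr₂ B) (tr₃ B)))).mapId X).hom := by
  change K.ho₂ (F.mapId X).hom (K.ho₂ (G.mapId X).hom (H.mapId X).hom ≫
      (K.tensor.mapId _).hom) ≫ (K.tensor.mapId _).hom =
    K.ho₂ (F.mapId X).hom (K.ho₂ (G.mapId X).hom (H.mapId X).hom) ≫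
      K.ho₂ (𝟙 _) (K.ho₂ (𝟙 _) (𝟙 _) ≫ (K.tensor.mapId _).hom) ≫ (K.tensor.mapId _).hom
  rw [ho₂_id, Category.id_comp, ← Category.assoc, ← ho₂_comp, Category.comp_id]

theorem mapComp_left (F G H : E ⥤ᵖ B) {X Y Z : E} (f : X ⟶ Y) (g : Y ⟶ Z) :
    ((K.T (K.T F G) H).mapComp f g).hom =
      (((pair F (pair G H)).comp (K.T (K.T (tr₁ B) (tr₂ B)) (tr₃ B))).mapComp f g).hom := by
  change K.ho₂ (K.ho₂ (F.mapComp f g).hom (G.mapComp f g).hom ≫ (K.hoComp _ _ _ _).hom)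
      (H.mapComp f g).hom ≫ (K.hoComp _ _ _ _).hom =
    K.ho₂ (K.ho₂ (F.mapComp f g).hom (G.mapComp f g).hom) (H.mapComp f g).hom ≫
      K.ho₂ (K.ho₂ (𝟙 _) (𝟙 _) ≫ (K.hoComp _ _ _ _).hom) (𝟙 _) ≫
        (K.hoComp _ _ _ _).hom
  rw [ho₂_id, Category.id_comp, ← Category.assoc, ← ho₂_comp, Category.comp_id]

theorem mapComp_right (F G H : E ⥤ᵖ B) {X Y Z : E} (f : X ⟶ Y) (g : Y ⟶ Z) :
    ((K.T F (K.T G H)).mapComp f g).hom =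
      (((pair F (pair G H)).comp (K.T (tr₁ B) (K.T (tr₂ B) (tr₃ B)))).mapComp f g).hom := by
  change K.ho₂ (F.mapComp f g).hom (K.ho₂ (G.mapComp f g).hom (H.mapComp f g).hom ≫
      (K.hoComp _ _ _ _).hom) ≫ (K.hoComp _ _ _ _).hom =
    K.ho₂ (F.mapComp f g).hom (K.ho₂ (G.mapComp f g).hom (H.mapComp f g).hom) ≫
      K.ho₂ (𝟙 _) (K.ho₂ (𝟙 _) (𝟙 _) ≫ (K.hoComp _ _ _ _).hom) ≫
        (K.hoComp _ _ _ _).hom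
  rw [ho₂_id, Category.id_comp, ← Category.assoc, ← ho₂_comp, Category.comp_id]

/-- The associator restricted along three pseudofunctors. -/
def assocAt (F G H : E ⥤ᵖ B) : K.T (K.T F G) H ⟶ K.T F (K.T G H) where
  app X := K.assoc.hom.app (F.obj X, G.obj X, H.obj X)
  naturality f := K.assoc.hom.naturality (F.map f ×ₘ (G.map f ×ₘ H.map f))
  naturality_naturality φ :=
    (preWhisker (pair F (pair G H)) K.assoc.hom).naturality_naturality φ
  naturality_id X := id_law ((preWhisker (pair F (pair G H)) K.assoc.hom).naturality_id X)
    (K.mapId_left F G H X) (K.mapId_right F G H X)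
  naturality_comp f g := comp_law
    ((preWhisker (pair F (pair G H)) K.assoc.hom).naturality_comp f g)
    (K.mapComp_left F G H f g) (K.mapComp_right F G H f g)

/-- The inverse of the associator restricted along three pseudofunctors. -/
def assocInvAt (F G H : E ⥤ᵖ B) : K.T F (K.T G H) ⟶ K.T (K.T F G) H where
  app X := K.assoc.inv.app (F.obj X, G.obj X, H.obj X)
  naturality f := K.assoc.inv.naturality (F.map f ×ₘ (G.map f ×ₘ H.map f))
  naturality_naturality φ :=
    (preWhisker (pair F (pair G H)) K.assoc.inv).naturality_naturality φ
  naturality_id X := id_law ((preWhisker (pair F (pair G H)) K.assoc.inv).naturality_id X)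
    (K.mapId_right F G H X) (K.mapId_left F G H X)
  naturality_comp f g := comp_law
    ((preWhisker (pair F (pair G H)) K.assoc.inv).naturality_comp f g)
    (K.mapComp_right F G H f g) (K.mapComp_left F G H f g)

theorem mapId_pair (F G : E ⥤ᵖ B) (X : E) :
    ((K.T F G).mapId X).hom =
      (((pair F G).comp (K.T (pr₁ B) (pr₂ B))).mapId X).hom := by
  change K.ho₂ (F.mapId X).hom (G.mapId X).hom ≫ (K.tensor.mapId _).hom =
    K.ho₂ (F.mapId X).hom (G.mapId X).hom ≫ K.ho₂ (𝟙 _) (𝟙 _) ≫ (K.tensor.mapId _).hom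
  rw [ho₂_id, Category.id_comp]

theorem mapId_pair_symm (F G : E ⥤ᵖ B) (X : E) :
    ((K.T G F).mapId X).hom =
      (((pair F G).comp (K.T (pr₂ B) (pr₁ B))).mapId X).hom := by
  change K.ho₂ (G.mapId X).hom (F.mapId X).hom ≫ (K.tensor.mapId _).hom =
    K.ho₂ (G.mapId X).hom (F.mapId X).hom ≫ K.ho₂ (𝟙 _) (𝟙 _) ≫ (K.tensor.mapId _).hom
  rw [ho₂_id, Category.id_comp]

theorem mapComp_pair (F G : E ⥤ᵖ B) {X Y Z : E} (f : X ⟶ Y) (g : Y ⟶ Z) :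
    ((K.T F G).mapComp f g).hom =
      (((pair F G).comp (K.T (pr₁ B) (pr₂ B))).mapComp f g).hom := by
  change K.ho₂ (F.mapComp f g).hom (G.mapComp f g).hom ≫ (K.hoComp _ _ _ _).hom =
    K.ho₂ (F.mapComp f g).hom (G.mapComp f g).hom ≫ K.ho₂ (𝟙 _) (𝟙 _) ≫
      (K.hoComp _ _ _ _).hom
  rw [ho₂_id, Category.id_comp]

theorem mapComp_pair_symm (F G : E ⥤ᵖ B) {X Y Z : E} (f : X ⟶ Y) (g : Y ⟶ Z) :
    ((K.T G F).mapComp f g).hom =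
      (((pair F G).comp (K.T (pr₂ B) (pr₁ B))).mapComp f g).hom := by
  change K.ho₂ (G.mapComp f g).hom (F.mapComp f g).hom ≫ (K.hoComp _ _ _ _).hom =
    K.ho₂ (G.mapComp f g).hom (F.mapComp f g).hom ≫ K.ho₂ (𝟙 _) (𝟙 _) ≫
      (K.hoComp _ _ _ _).hom
  rw [ho₂_id, Category.id_comp]

theorem mapId_one_left (F : E ⥤ᵖ B) (X : E) :
    ((K.T (K.one E) F).mapId X).hom =
      ((F.comp (K.T (K.one B) (Pseudofunctor.id B))).mapId X).hom := by
  change K.ho₂ (𝟙 _) (F.mapId X).hom ≫ (K.tensor.mapId _).hom =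
    K.ho₂ (𝟙 _) (F.mapId X).hom ≫ K.ho₂ (𝟙 _) (𝟙 _) ≫ (K.tensor.mapId _).hom
  rw [ho₂_id, Category.id_comp]

theorem mapId_one_right (F : E ⥤ᵖ B) (X : E) :
    ((K.T F (K.one E)).mapId X).hom =
      ((F.comp (K.T (Pseudofunctor.id B) (K.one B))).mapId X).hom := by
  change K.ho₂ (F.mapId X).hom (𝟙 _) ≫ (K.tensor.mapId _).hom =
    K.ho₂ (F.mapId X).hom (𝟙 _) ≫ K.ho₂ (𝟙 _) (𝟙 _) ≫ (K.tensor.mapId _).hom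
  rw [ho₂_id, Category.id_comp]

theorem mapComp_one_left (F : E ⥤ᵖ B) {X Y Z : E} (f : X ⟶ Y) (g : Y ⟶ Z) :
    ((K.T (K.one E) F).mapComp f g).hom =
      ((F.comp (K.T (K.one B) (Pseudofunctor.id B))).mapComp f g).hom := by
  change K.ho₂ (λ_ (𝟙 K.unit)).inv (F.mapComp f g).hom ≫ (K.hoComp _ _ _ _).hom =
    K.ho₂ (𝟙 _) (F.mapComp f g).hom ≫ K.ho₂ (λ_ (𝟙 K.unit)).inv (𝟙 _) ≫
      (K.hoComp _ _ _ _).hom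
  rw [← Category.assoc, ← ho₂_comp, Category.id_comp, Category.comp_id]

theorem mapComp_one_right (F : E ⥤ᵖ B) {X Y Z : E} (f : X ⟶ Y) (g : Y ⟶ Z) :
    ((K.T F (K.one E)).mapComp f g).hom =
      ((F.comp (K.T (Pseudofunctor.id B) (K.one B))).mapComp f g).hom := by
  change K.ho₂ (F.mapComp f g).hom (λ_ (𝟙 K.unit)).inv ≫ (K.hoComp _ _ _ _).hom =
    K.ho₂ (F.mapComp f g).hom (𝟙 _) ≫ K.ho₂ (𝟙 _) (λ_ (𝟙 K.unit)).inv ≫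
      (K.hoComp _ _ _ _).hom
  rw [← Category.assoc, ← ho₂_comp, Category.id_comp, Category.comp_id]

/-- The left unitor restricted along a pseudofunctor. -/
def leftUnitorAt (F : E ⥤ᵖ B) : K.T (K.one E) F ⟶ F where
  app X := K.leftUnitor.hom.app (F.obj X)
  naturality f := K.leftUnitor.hom.naturality (F.map f)
  naturality_naturality φ := (preWhisker F K.leftUnitor.hom).naturality_naturality φ
  naturality_id X := id_law ((preWhisker F K.leftUnitor.hom).naturality_id X)
    (K.mapId_one_left F X) (Category.comp_id _).symm
  naturality_comp f g := comp_law ((preWhisker F K.leftUnitor.hom).naturality_comp f g)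
    (K.mapComp_one_left F f g) (Category.comp_id _).symm

/-- The right unitor restricted along a pseudofunctor. -/
def rightUnitorAt (F : E ⥤ᵖ B) : K.T F (K.one E) ⟶ F where
  app X := K.rightUnitor.hom.app (F.obj X)
  naturality f := K.rightUnitor.hom.naturality (F.map f)
  naturality_naturality φ := (preWhisker F K.rightUnitor.hom).naturality_naturality φ
  naturality_id X := id_law ((preWhisker F K.rightUnitor.hom).naturality_id X)
    (K.mapId_one_right F X) (Category.comp_id _).symm
  naturality_comp f g := comp_law ((preWhisker F K.rightUnitor.hom).naturality_comp f g)
    (K.mapComp_one_right F f g) (Category.comp_id _).symm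

/-- A pseudonatural transformation `a ⊗ b ⟶ b ⊗ a` restricted along two pseudofunctors. -/
def braidAt (β : K.T (pr₁ B) (pr₂ B) ⟶ K.T (pr₂ B) (pr₁ B)) (F G : E ⥤ᵖ B) :
    K.T F G ⟶ K.T G F where
  app X := β.app (F.obj X, G.obj X)
  naturality f := β.naturality (F.map f ×ₘ G.map f)
  naturality_naturality φ := (preWhisker (pair F G) β).naturality_naturality φ
  naturality_id X := id_law ((preWhisker (pair F G) β).naturality_id X)
    (K.mapId_pair F G X) (K.mapId_pair_symm F G X)
  naturality_comp f g := comp_law ((preWhisker (pair F G) β).naturality_comp f g)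
    (K.mapComp_pair F G f g) (K.mapComp_pair_symm F G f g)

/-- The 2-associator `((a ⊗ b) ⊗ c) ⊗ d ⟶ a ⊗ (b ⊗ (c ⊗ d))`, an invertible modification. -/
abbrev Pentagonator :=
  K.tensorTrans (K.assocAt (qr₁ B) (qr₂ B) (qr₃ B)) (𝟙 (qr₄ B)) ≫
      K.assocAt (qr₁ B) (K.T (qr₂ B) (qr₃ B)) (qr₄ B) ≫
      K.tensorTrans (𝟙 (qr₁ B)) (K.assocAt (qr₂ B) (qr₃ B) (qr₄ B)) ≅
    K.assocAt (K.T (qr₁ B) (qr₂ B)) (qr₃ B) (qr₄ B) ≫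
      K.assocAt (qr₁ B) (qr₂ B) (K.T (qr₃ B) (qr₄ B))

/-- The left 2-unitor `(I ⊗ a) ⊗ b ⟶ a ⊗ b`, an invertible modification. -/
abbrev LeftTwoUnitor :=
  K.tensorTrans (K.leftUnitorAt (pr₁ B)) (𝟙 (pr₂ B)) ≅
    K.assocAt (K.one (B × B)) (pr₁ B) (pr₂ B) ≫ K.leftUnitorAt (K.T (pr₁ B) (pr₂ B))

/-- The middle 2-unitor `(a ⊗ I) ⊗ b ⟶ a ⊗ b`, an invertible modification. -/
abbrev MiddleTwoUnitor :=
  K.tensorTrans (K.rightUnitorAt (pr₁ B)) (𝟙 (pr₂ B)) ≅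
    K.assocAt (pr₁ B) (K.one (B × B)) (pr₂ B) ≫
      K.tensorTrans (𝟙 (pr₁ B)) (K.leftUnitorAt (pr₂ B))

/-- The right 2-unitor `(a ⊗ b) ⊗ I ⟶ a ⊗ b`, an invertible modification. -/
abbrev RightTwoUnitor :=
  K.rightUnitorAt (K.T (pr₁ B) (pr₂ B)) ≅
    K.assocAt (pr₁ B) (pr₂ B) (K.one (B × B)) ≫
      K.tensorTrans (𝟙 (pr₁ B)) (K.rightUnitorAt (pr₂ B))

/-- A braid: a pseudonatural adjoint equivalence `a ⊗ b ≌ b ⊗ a`. -/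
abbrev Braid := K.T (pr₁ B) (pr₂ B) ≌ K.T (pr₂ B) (pr₁ B)

variable {K}

/-- The components of a braid, restricted along two pseudofunctors. -/
abbrev Braid.along (β : K.Braid) (F G : E ⥤ᵖ B) : K.T F G ⟶ K.T G F := K.braidAt β.hom F G

/-- The left 2-braid `(a ⊗ b) ⊗ c ⟶ b ⊗ (c ⊗ a)`, an invertible modification. -/
abbrev LeftTwoBraid (β : K.Braid) :=
  K.assocAt (tr₁ B) (tr₂ B) (tr₃ B) ≫ β.along (tr₁ B) (K.T (tr₂ B) (tr₃ B)) ≫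
      K.assocAt (tr₂ B) (tr₃ B) (tr₁ B) ≅
    K.tensorTrans (β.along (tr₁ B) (tr₂ B)) (𝟙 (tr₃ B)) ≫
      K.assocAt (tr₂ B) (tr₁ B) (tr₃ B) ≫
      K.tensorTrans (𝟙 (tr₂ B)) (β.along (tr₁ B) (tr₃ B))

/-- The right 2-braid `a ⊗ (b ⊗ c) ⟶ (c ⊗ a) ⊗ b`, an invertible modification. -/
abbrev RightTwoBraid (β : K.Braid) :=
  K.assocInvAt (tr₁ B) (tr₂ B) (tr₃ B) ≫ β.along (K.T (tr₁ B) (tr₂ B)) (tr₃ B) ≫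
      K.assocInvAt (tr₃ B) (tr₁ B) (tr₂ B) ≅
    K.tensorTrans (𝟙 (tr₁ B)) (β.along (tr₂ B) (tr₃ B)) ≫
      K.assocInvAt (tr₁ B) (tr₃ B) (tr₂ B) ≫
      K.tensorTrans (β.along (tr₁ B) (tr₃ B)) (𝟙 (tr₂ B))

/-- The syllepsis, an invertible modification. -/
abbrev Syllepsis (β : K.Braid) :=
  β.along (pr₁ B) (pr₂ B) ≫ β.along (pr₂ B) (pr₁ B) ≅ 𝟙 (K.T (pr₁ B) (pr₂ B))

end TensorBicategory

/-- The data of a symmetric monoidal bicategory. -/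
structure SymmetricData (B : Type u) [Bicategory.{w, v} B] extends TensorBicategory B where
  pentagonator : toTensorBicategory.Pentagonator
  leftTwoUnitor : toTensorBicategory.LeftTwoUnitor
  middleTwoUnitor : toTensorBicategory.MiddleTwoUnitor
  rightTwoUnitor : toTensorBicategory.RightTwoUnitor
  braid : toTensorBicategory.Braid
  leftTwoBraid : TensorBicategory.LeftTwoBraid braid
  rightTwoBraid : TensorBicategory.RightTwoBraid braid
  syllepsis : TensorBicategory.Syllepsis braid

/-- The component of an invertible modification. -/
def appIso {E : Type u₁} [Bicategory.{w₁, v₁} E] {C : Type u₂} [Bicategory.{w₂, v₂} C]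
    {F G : E ⥤ᵖ C} {η θ : F ⟶ G} (Γ : η ≅ θ) (X : E) : η.app X ≅ θ.app X where
  hom := Γ.hom.as.app X
  inv := Γ.inv.as.app X
  hom_inv_id := congrArg (fun m => Pseudofunctor.StrongTrans.Modification.app m.as X)
    Γ.hom_inv_id
  inv_hom_id := congrArg (fun m => Pseudofunctor.StrongTrans.Modification.app m.as X)
    Γ.inv_hom_id

namespace SymmetricData
variable {B : Type u} [Bicategory.{w, v} B] (K : SymmetricData B)

/-- The tensor product of objects. -/
abbrev t (a b : B) : B := K.tensor.obj (a, b)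

/-- The tensor product `f ⊗ b` of a 1-cell and an object. -/
def wr {a a' : B} (f : a ⟶ a') (b : B) : K.t a b ⟶ K.t a' b :=
  K.tensor.map (Prod.mkHom f (𝟙 b))

/-- The tensor product `a ⊗ g` of an object and a 1-cell. -/
def wl (a : B) {b b' : B} (g : b ⟶ b') : K.t a b ⟶ K.t a b' :=
  K.tensor.map (Prod.mkHom (𝟙 a) g)

/-- The tensor product of invertible 2-cells. -/
def isoTensor {a a' b b' : B} {f f' : a ⟶ a'} {g g' : b ⟶ b'} (φ : f ≅ f') (ψ : g ≅ g') :
    K.ho f g ≅ K.ho f' g' :=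
  K.tensor.map₂Iso (a := (a, b)) (b := (a', b')) (f := Prod.mkHom f g)
    (g := Prod.mkHom f' g') (Iso.prod φ ψ)

/-- The 2-cell `φ ⊗ b`. -/
def wr₂ {a a' : B} {f f' : a ⟶ a'} (φ : f ≅ f') (b : B) : K.wr f b ≅ K.wr f' b :=
  K.isoTensor φ (Iso.refl (𝟙 b))

/-- The 2-cell `a ⊗ ψ`. -/
def wl₂ (a : B) {b b' : B} {g g' : b ⟶ b'} (ψ : g ≅ g') : K.wl a g ≅ K.wl a g' :=
  K.isoTensor (Iso.refl (𝟙 a)) ψ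

def wrId (a b : B) : K.wr (𝟙 a) b ≅ 𝟙 (K.t a b) := K.hoId a b

def wlId (a b : B) : K.wl a (𝟙 b) ≅ 𝟙 (K.t a b) := K.hoId a b

def wrComp {a a' a'' : B} (f : a ⟶ a') (f' : a' ⟶ a'') (b : B) :
    K.wr (f ≫ f') b ≅ K.wr f b ≫ K.wr f' b :=
  K.isoTensor (Iso.refl (f ≫ f')) (λ_ (𝟙 b)).symm ≪≫ K.hoComp f f' (𝟙 b) (𝟙 b)

def wlComp (a : B) {b b' b'' : B} (g : b ⟶ b') (g' : b' ⟶ b'') :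
    K.wl a (g ≫ g') ≅ K.wl a g ≫ K.wl a g' :=
  K.isoTensor (λ_ (𝟙 a)).symm (Iso.refl (g ≫ g')) ≪≫ K.hoComp (𝟙 a) (𝟙 a) g g'

def wrComp₃ {a₁ a₂ a₃ a₄ : B} (f : a₁ ⟶ a₂) (g : a₂ ⟶ a₃) (h : a₃ ⟶ a₄) (b : B) :
    K.wr (f ≫ g ≫ h) b ≅ K.wr f b ≫ K.wr g b ≫ K.wr h b :=
  K.wrComp f (g ≫ h) b ≪≫ K.wr f b ◁ᵢ K.wrComp g h b

def wlComp₃ (a : B) {b₁ b₂ b₃ b₄ : B} (f : b₁ ⟶ b₂) (g : b₂ ⟶ b₃) (h : b₃ ⟶ b₄) :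
    K.wl a (f ≫ g ≫ h) ≅ K.wl a f ≫ K.wl a g ≫ K.wl a h :=
  K.wlComp a f (g ≫ h) ≪≫ K.wl a f ◁ᵢ K.wlComp a g h

/-- The interchange of `f ⊗ -` and `- ⊗ g`. -/
def exch {a a' b b' : B} (f : a ⟶ a') (g : b ⟶ b') :
    K.wr f b ≫ K.wl a' g ≅ K.wl a g ≫ K.wr f b' :=
  (K.hoComp f (𝟙 a') (𝟙 b) g).symm ≪≫
    K.isoTensor (ρ_ f ≪≫ (λ_ f).symm) (λ_ g ≪≫ (ρ_ g).symm) ≪≫ K.hoComp (𝟙 a) f g (𝟙 b')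

/-- The associator. -/
def α (a b c : B) : K.t (K.t a b) c ⟶ K.t a (K.t b c) := K.assoc.hom.app (a, b, c)

/-- The inverse associator. -/
def α' (a b c : B) : K.t a (K.t b c) ⟶ K.t (K.t a b) c := K.assoc.inv.app (a, b, c)

/-- The left unitor. -/
def l (a : B) : K.t K.unit a ⟶ a := K.leftUnitor.hom.app a

/-- The inverse left unitor. -/
def l' (a : B) : a ⟶ K.t K.unit a := K.leftUnitor.inv.app a

/-- The right unitor. -/
def r (a : B) : K.t a K.unit ⟶ a := K.rightUnitor.hom.app a

/-- The inverse right unitor. -/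
def r' (a : B) : a ⟶ K.t a K.unit := K.rightUnitor.inv.app a

/-- The braid. -/
def β (a b : B) : K.t a b ⟶ K.t b a := K.braid.hom.app (a, b)

/-- Pseudonaturality of the associator in its first variable; likewise below for the other
variables, for the inverse associator and for the braid. -/
def αnat₁ {a a' : B} (f : a ⟶ a') (b c : B) :
    K.wr (K.wr f b) c ≫ K.α a' b c ≅ K.α a b c ≫ K.wr f (K.t b c) :=
  K.assoc.hom.naturality (a := (a, b, c)) (b := (a', b, c))
      (Prod.mkHom f (Prod.mkHom (𝟙 b) (𝟙 c))) ≪≫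
    K.α a b c ◁ᵢ K.isoTensor (Iso.refl f) (K.hoId b c)

def αnat₂ (a : B) {b b' : B} (g : b ⟶ b') (c : B) :
    K.wr (K.wl a g) c ≫ K.α a b' c ≅ K.α a b c ≫ K.wl a (K.wr g c) :=
  K.assoc.hom.naturality (a := (a, b, c)) (b := (a, b', c))
    (Prod.mkHom (𝟙 a) (Prod.mkHom g (𝟙 c)))

def αnat₃ (a b : B) {c c' : B} (h : c ⟶ c') :
    K.wl (K.t a b) h ≫ K.α a b c' ≅ K.α a b c ≫ K.wl a (K.wl b h) :=
  K.isoTensor (K.hoId a b).symm (Iso.refl h) ▷ᵢ K.α a b c' ≪≫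
    K.assoc.hom.naturality (a := (a, b, c)) (b := (a, b, c'))
      (Prod.mkHom (𝟙 a) (Prod.mkHom (𝟙 b) h))

def α'nat₁ {a a' : B} (f : a ⟶ a') (b c : B) :
    K.wr f (K.t b c) ≫ K.α' a' b c ≅ K.α' a b c ≫ K.wr (K.wr f b) c :=
  K.isoTensor (Iso.refl f) (K.hoId b c).symm ▷ᵢ K.α' a' b c ≪≫
    K.assoc.inv.naturality (a := (a, b, c)) (b := (a', b, c))
      (Prod.mkHom f (Prod.mkHom (𝟙 b) (𝟙 c)))

def α'nat₂ (a : B) {b b' : B} (g : b ⟶ b') (c : B) :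
    K.wl a (K.wr g c) ≫ K.α' a b' c ≅ K.α' a b c ≫ K.wr (K.wl a g) c :=
  K.assoc.inv.naturality (a := (a, b, c)) (b := (a, b', c))
    (Prod.mkHom (𝟙 a) (Prod.mkHom g (𝟙 c)))

def α'nat₃ (a b : B) {c c' : B} (h : c ⟶ c') :
    K.wl a (K.wl b h) ≫ K.α' a b c' ≅ K.α' a b c ≫ K.wl (K.t a b) h :=
  K.assoc.inv.naturality (a := (a, b, c)) (b := (a, b, c'))
      (Prod.mkHom (𝟙 a) (Prod.mkHom (𝟙 b) h)) ≪≫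
    K.α' a b c ◁ᵢ K.isoTensor (K.hoId a b) (Iso.refl h)

def βnat₁ {a a' : B} (f : a ⟶ a') (b : B) :
    K.wr f b ≫ K.β a' b ≅ K.β a b ≫ K.wl b f :=
  K.braid.hom.naturality (a := (a, b)) (b := (a', b)) (Prod.mkHom f (𝟙 b))

def βnat₂ (a : B) {b b' : B} (g : b ⟶ b') :
    K.wl a g ≫ K.β a b' ≅ K.β a b ≫ K.wr g a :=
  K.braid.hom.naturality (a := (a, b)) (b := (a, b')) (Prod.mkHom (𝟙 a) g)

/-- The unit of the adjoint equivalence formed by the associator and its inverse. -/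
def u (a b c : B) : 𝟙 (K.t (K.t a b) c) ≅ K.α a b c ≫ K.α' a b c :=
  appIso K.assoc.unit (a, b, c)

/-- The counit of the adjoint equivalence formed by the associator and its inverse. -/
def c (a b c : B) : K.α' a b c ≫ K.α a b c ≅ 𝟙 (K.t a (K.t b c)) :=
  appIso K.assoc.counit (a, b, c)

/-- The 2-associator. -/
def π (a b c d : B) :
    K.wr (K.α a b c) d ≫ K.α a (K.t b c) d ≫ K.wl a (K.α b c d) ≅
      K.α (K.t a b) c d ≫ K.α a b (K.t c d) :=
  appIso K.pentagonator (a, b, c, d)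

/-- The left 2-unitor. -/
def lam (a b : B) : K.wr (K.l a) b ≅ K.α K.unit a b ≫ K.l (K.t a b) :=
  appIso K.leftTwoUnitor (a, b)

/-- The middle 2-unitor. -/
def mu (a b : B) : K.wr (K.r a) b ≅ K.α a K.unit b ≫ K.wl a (K.l b) :=
  appIso K.middleTwoUnitor (a, b)

/-- The right 2-unitor. -/
def rho (a b : B) : K.r (K.t a b) ≅ K.α a b K.unit ≫ K.wl a (K.r b) :=
  appIso K.rightTwoUnitor (a, b)

/-- The left 2-braid. -/
def R (a b c : B) :
    K.α a b c ≫ K.β a (K.t b c) ≫ K.α b c a ≅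
      K.wr (K.β a b) c ≫ K.α b a c ≫ K.wl b (K.β a c) :=
  appIso K.leftTwoBraid (a, b, c)

/-- The right 2-braid. -/
def S (a b c : B) :
    K.α' a b c ≫ K.β (K.t a b) c ≫ K.α' c a b ≅
      K.wl a (K.β b c) ≫ K.α' a c b ≫ K.wr (K.β a c) b :=
  appIso K.rightTwoBraid (a, b, c)

/-- The syllepsis. -/
def σ (a b : B) : K.β a b ≫ K.β b a ≅ 𝟙 (K.t a b) :=
  appIso K.syllepsis (a, b)

/-- The 2-cell `u` tensored with an object on the left; in the same way, a suffix `l` or `r` below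
marks a 2-cell tensored with an object on the left or on the right, written as a 2-cell between
composites of tensored 1-cells. -/
def ul (a b c d : B) : 𝟙 (K.t a (K.t (K.t b c) d)) ≅ K.wl a (K.α b c d) ≫ K.wl a (K.α' b c d) :=
  (K.wlId a (K.t (K.t b c) d)).symm ≪≫ K.wl₂ a (K.u b c d) ≪≫ K.wlComp a _ _

def cl (a b c d : B) : K.wl a (K.α' b c d) ≫ K.wl a (K.α b c d) ≅ 𝟙 (K.t a (K.t b (K.t c d))) :=
  (K.wlComp a _ _).symm ≪≫ K.wl₂ a (K.c b c d) ≪≫ K.wlId a (K.t b (K.t c d))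

def cr (a b c d : B) : K.wr (K.α' a b c) d ≫ K.wr (K.α a b c) d ≅ 𝟙 (K.t (K.t a (K.t b c)) d) :=
  (K.wrComp _ _ d).symm ≪≫ K.wr₂ (K.c a b c) d ≪≫ K.wrId (K.t a (K.t b c)) d

def πr (a b c d e : B) :
    K.wr (K.wr (K.α a b c) d) e ≫ K.wr (K.α a (K.t b c) d) e ≫ K.wr (K.wl a (K.α b c d)) e ≅
      K.wr (K.α (K.t a b) c d) e ≫ K.wr (K.α a b (K.t c d)) e :=
  (K.wrComp₃ _ _ _ e).symm ≪≫ K.wr₂ (K.π a b c d) e ≪≫ K.wrComp _ _ e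

def πl (a b c d e : B) :
    K.wl a (K.wr (K.α b c d) e) ≫ K.wl a (K.α b (K.t c d) e) ≫ K.wl a (K.wl b (K.α c d e)) ≅
      K.wl a (K.α (K.t b c) d e) ≫ K.wl a (K.α b c (K.t d e)) :=
  (K.wlComp₃ a _ _ _).symm ≪≫ K.wl₂ a (K.π b c d e) ≪≫ K.wlComp a _ _

def Rr (a b c d : B) :
    K.wr (K.α a b c) d ≫ K.wr (K.β a (K.t b c)) d ≫ K.wr (K.α b c a) d ≅
      K.wr (K.wr (K.β a b) c) d ≫ K.wr (K.α b a c) d ≫ K.wr (K.wl b (K.β a c)) d :=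
  (K.wrComp₃ _ _ _ d).symm ≪≫ K.wr₂ (K.R a b c) d ≪≫ K.wrComp₃ _ _ _ d

def Rl (a b c d : B) :
    K.wl a (K.α b c d) ≫ K.wl a (K.β b (K.t c d)) ≫ K.wl a (K.α c d b) ≅
      K.wl a (K.wr (K.β b c) d) ≫ K.wl a (K.α c b d) ≫ K.wl a (K.wl c (K.β b d)) :=
  (K.wlComp₃ a _ _ _).symm ≪≫ K.wl₂ a (K.R b c d) ≪≫ K.wlComp₃ a _ _ _

def Sr (a b c d : B) :
    K.wr (K.α' a b c) d ≫ K.wr (K.β (K.t a b) c) d ≫ K.wr (K.α' c a b) d ≅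
      K.wr (K.wl a (K.β b c)) d ≫ K.wr (K.α' a c b) d ≫ K.wr (K.wr (K.β a c) b) d :=
  (K.wrComp₃ _ _ _ d).symm ≪≫ K.wr₂ (K.S a b c) d ≪≫ K.wrComp₃ _ _ _ d

def Sl (a b c d : B) :
    K.wl a (K.α' b c d) ≫ K.wl a (K.β (K.t b c) d) ≫ K.wl a (K.α' d b c) ≅
      K.wl a (K.wl b (K.β c d)) ≫ K.wl a (K.α' b d c) ≫ K.wl a (K.wr (K.β b d) c) :=
  (K.wlComp₃ a _ _ _).symm ≪≫ K.wl₂ a (K.S b c d) ≪≫ K.wlComp₃ a _ _ _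

def σr (a b c : B) : K.wr (K.β a b) c ≫ K.wr (K.β b a) c ≅ 𝟙 (K.t (K.t a b) c) :=
  (K.wrComp _ _ c).symm ≪≫ K.wr₂ (K.σ a b) c ≪≫ K.wrId (K.t a b) c

def σl (a b c : B) : K.wl a (K.β b c) ≫ K.wl a (K.β c b) ≅ 𝟙 (K.t a (K.t b c)) :=
  (K.wlComp a _ _).symm ≪≫ K.wl₂ a (K.σ b c) ≪≫ K.wlId a (K.t b c)

/-- The 2-associator for the inverse associators. -/
def π' (a b c d : B) :
    K.wl a (K.α' b c d) ≫ K.α' a (K.t b c) d ≫ K.wr (K.α' a b c) d ≅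
      K.α' a b (K.t c d) ≫ K.α' (K.t a b) c d :=
  Iso.refl _ ≪⊗≫
  (K.wl a (K.α' b c d) ≫ K.α' a (K.t b c) d ≫ K.wr (K.α' a b c) d) ◁ᵢ K.u (K.t a b) c d ≪⊗≫
  (K.wl a (K.α' b c d) ≫ K.α' a (K.t b c) d ≫ K.wr (K.α' a b c) d ≫ K.α (K.t a b) c d) ◁ᵢ
    K.u a b (K.t c d) ▷ᵢ K.α' (K.t a b) c d ≪⊗≫
  (K.wl a (K.α' b c d) ≫ K.α' a (K.t b c) d ≫ K.wr (K.α' a b c) d) ◁ᵢ (K.π a b c d).symm ▷ᵢ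
    (K.α' a b (K.t c d) ≫ K.α' (K.t a b) c d) ≪⊗≫
  (K.wl a (K.α' b c d) ≫ K.α' a (K.t b c) d) ◁ᵢ K.cr a b c d ▷ᵢ
    (K.α a (K.t b c) d ≫ K.wl a (K.α b c d) ≫ K.α' a b (K.t c d) ≫ K.α' (K.t a b) c d) ≪⊗≫
  K.wl a (K.α' b c d) ◁ᵢ K.c a (K.t b c) d ▷ᵢ
    (K.wl a (K.α b c d) ≫ K.α' a b (K.t c d) ≫ K.α' (K.t a b) c d) ≪⊗≫
  K.cl a b c d ▷ᵢ (K.α' a b (K.t c d) ≫ K.α' (K.t a b) c d) ≪⊗≫ Iso.refl _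

/-- Rearrangements of the 2-associator in which some associators are replaced by inverses. -/
def P₁ (a b c d : B) :
    K.α a (K.t b c) d ≅
      K.wr (K.α' a b c) d ≫ K.α (K.t a b) c d ≫ K.α a b (K.t c d) ≫ K.wl a (K.α' b c d) :=
  Iso.refl _ ≪⊗≫
  (K.cr a b c d).symm ▷ᵢ K.α a (K.t b c) d ≪⊗≫
  (K.wr (K.α' a b c) d ≫ K.wr (K.α a b c) d ≫ K.α a (K.t b c) d) ◁ᵢ K.ul a b c d ≪⊗≫
  K.wr (K.α' a b c) d ◁ᵢ K.π a b c d ▷ᵢ K.wl a (K.α' b c d) ≪⊗≫ Iso.refl _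

def P₂ (a b c d : B) :
    K.wr (K.α' a b c) d ≫ K.α (K.t a b) c d ≅
      K.α a (K.t b c) d ≫ K.wl a (K.α b c d) ≫ K.α' a b (K.t c d) :=
  Iso.refl _ ≪⊗≫
  (K.wr (K.α' a b c) d ≫ K.α (K.t a b) c d) ◁ᵢ K.u a b (K.t c d) ≪⊗≫
  K.wr (K.α' a b c) d ◁ᵢ (K.π a b c d).symm ▷ᵢ K.α' a b (K.t c d) ≪⊗≫
  K.cr a b c d ▷ᵢ (K.α a (K.t b c) d ≫ K.wl a (K.α b c d) ≫ K.α' a b (K.t c d)) ≪⊗≫ Iso.refl _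

def P₃ (a b c d : B) :
    K.α a b (K.t c d) ≫ K.wl a (K.α' b c d) ≅
      K.α' (K.t a b) c d ≫ K.wr (K.α a b c) d ≫ K.α a (K.t b c) d :=
  Iso.refl _ ≪⊗≫
  (K.c (K.t a b) c d).symm ▷ᵢ (K.α a b (K.t c d) ≫ K.wl a (K.α' b c d)) ≪⊗≫
  K.α' (K.t a b) c d ◁ᵢ (K.π a b c d).symm ▷ᵢ K.wl a (K.α' b c d) ≪⊗≫
  (K.α' (K.t a b) c d ≫ K.wr (K.α a b c) d ≫ K.α a (K.t b c) d) ◁ᵢ (K.ul a b c d).symm ≪⊗≫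
  Iso.refl _

def P₄ (a b c d : B) :
    K.α' a (K.t b c) d ≅
      K.wl a (K.α b c d) ≫ K.α' a b (K.t c d) ≫ K.α' (K.t a b) c d ≫ K.wr (K.α a b c) d :=
  Iso.refl _ ≪⊗≫
  K.ul a b c d ▷ᵢ K.α' a (K.t b c) d ≪⊗≫
  (K.wl a (K.α b c d) ≫ K.wl a (K.α' b c d) ≫ K.α' a (K.t b c) d) ◁ᵢ (K.cr a b c d).symm ≪⊗≫
  K.wl a (K.α b c d) ◁ᵢ K.π' a b c d ▷ᵢ K.wr (K.α a b c) d ≪⊗≫ Iso.refl _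

/-- The associahedron axiom: the non-abelian 4-cocycle condition for the 2-associator. -/
def Associahedron : Prop := ∀ a b c d e : B,
  (K.πr a b c d e ▷ᵢ
      (K.α a (K.t b (K.t c d)) e ≫ K.wl a (K.α b (K.t c d) e) ≫ K.wl a (K.wl b (K.α c d e))) ≪⊗≫
    K.wr (K.α (K.t a b) c d) e ◁ᵢ K.π a b (K.t c d) e ▷ᵢ K.wl a (K.wl b (K.α c d e)) ≪⊗≫
    (K.wr (K.α (K.t a b) c d) e ≫ K.α (K.t a b) (K.t c d) e) ◁ᵢ (K.αnat₃ a b (K.α c d e)).symm ≪⊗≫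
    K.π (K.t a b) c d e ▷ᵢ K.α a b (K.t c (K.t d e)) ≪⊗≫
    Iso.refl (K.α (K.t (K.t a b) c) d e ≫ K.α (K.t a b) c (K.t d e) ≫ K.α a b (K.t c (K.t d e)))) =
  Iso.refl ((K.wr (K.wr (K.α a b c) d) e ≫ K.wr (K.α a (K.t b c) d) e ≫
      K.wr (K.wl a (K.α b c d)) e) ≫
      K.α a (K.t b (K.t c d)) e ≫ K.wl a (K.α b (K.t c d) e) ≫ K.wl a (K.wl b (K.α c d e))) ≪⊗≫
    (K.wr (K.wr (K.α a b c) d) e ≫ K.wr (K.α a (K.t b c) d) e) ◁ᵢ K.αnat₂ a (K.α b c d) e ▷ᵢ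
      (K.wl a (K.α b (K.t c d) e) ≫ K.wl a (K.wl b (K.α c d e))) ≪⊗≫
    (K.wr (K.wr (K.α a b c) d) e ≫ K.wr (K.α a (K.t b c) d) e ≫ K.α a (K.t (K.t b c) d) e) ◁ᵢ
      K.πl a b c d e ≪⊗≫
    K.wr (K.wr (K.α a b c) d) e ◁ᵢ K.π a (K.t b c) d e ▷ᵢ K.wl a (K.α b c (K.t d e)) ≪⊗≫
    K.αnat₁ (K.α a b c) d e ▷ᵢ (K.α a (K.t b c) (K.t d e) ≫ K.wl a (K.α b c (K.t d e))) ≪⊗≫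
    K.α (K.t (K.t a b) c) d e ◁ᵢ K.π a b c (K.t d e) ≪⊗≫ Iso.refl _

/-- The axiom relating the 2-associator to the left and middle 2-unitors. -/
def UnitLeft : Prop := ∀ a b c : B,
  (K.αnat₁ (K.r a) b c ≪⊗≫ K.α (K.t a K.unit) b c ◁ᵢ K.mu a (K.t b c) ≪⊗≫
    Iso.refl (K.α (K.t a K.unit) b c ≫ K.α a K.unit (K.t b c) ≫ K.wl a (K.l (K.t b c)))) =
  (K.wr₂ (K.mu a b) c ≪≫ K.wrComp _ _ c) ▷ᵢ K.α a b c ≪⊗≫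
    K.wr (K.α a K.unit b) c ◁ᵢ K.αnat₂ a (K.l b) c ≪⊗≫
    (K.wr (K.α a K.unit b) c ≫ K.α a (K.t K.unit b) c) ◁ᵢ
      (K.wl₂ a (K.lam b c) ≪≫ K.wlComp a _ _) ≪⊗≫
    K.π a K.unit b c ▷ᵢ K.wl a (K.l (K.t b c)) ≪⊗≫ Iso.refl _

/-- The axiom relating the 2-associator to the middle and right 2-unitors. -/
def UnitRight : Prop := ∀ a b c : B,
  (K.mu (K.t a b) c ▷ᵢ K.α a b c ≪⊗≫ K.α (K.t a b) K.unit c ◁ᵢ K.αnat₃ a b (K.l c) ≪⊗≫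
    Iso.refl (K.α (K.t a b) K.unit c ≫ K.α a b (K.t K.unit c) ≫ K.wl a (K.wl b (K.l c)))) =
  (K.wr₂ (K.rho a b) c ≪≫ K.wrComp _ _ c) ▷ᵢ K.α a b c ≪⊗≫
    K.wr (K.α a b K.unit) c ◁ᵢ K.αnat₂ a (K.r b) c ≪⊗≫
    (K.wr (K.α a b K.unit) c ≫ K.α a (K.t b K.unit) c) ◁ᵢ
      (K.wl₂ a (K.mu b c) ≪≫ K.wlComp a _ _) ≪⊗≫
    K.π a b K.unit c ▷ᵢ K.wl a (K.wl b (K.l c)) ≪⊗≫ Iso.refl _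

/-- The axiom for the left 2-braid and the 2-associator: braiding `a` past `b`, `c` and `d`. -/
def BraidLeft : Prop := ∀ a b c d : B,
  Iso.refl (K.wr (K.α a b c) d ≫ K.α a (K.t b c) d ≫ K.β a (K.t (K.t b c) d) ≫ K.α (K.t b c) d a ≫
      K.α b c (K.t d a)) ≪⊗≫
    K.wr (K.α a b c) d ◁ᵢ K.R a (K.t b c) d ▷ᵢ K.α b c (K.t d a) ≪⊗≫
    (K.wr (K.α a b c) d ≫ K.wr (K.β a (K.t b c)) d ≫ K.α (K.t b c) a d) ◁ᵢ
      K.αnat₃ b c (K.β a d) ≪⊗≫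
    (K.wr (K.α a b c) d ≫ K.wr (K.β a (K.t b c)) d) ◁ᵢ (K.π b c a d).symm ▷ᵢ
      K.wl b (K.wl c (K.β a d)) ≪⊗≫
    K.Rr a b c d ▷ᵢ (K.α b (K.t c a) d ≫ K.wl b (K.α c a d) ≫ K.wl b (K.wl c (K.β a d))) ≪⊗≫
    Iso.refl (K.wr (K.wr (K.β a b) c) d ≫ K.wr (K.α b a c) d ≫ K.wr (K.wl b (K.β a c)) d ≫
      K.α b (K.t c a) d ≫ K.wl b (K.α c a d) ≫ K.wl b (K.wl c (K.β a d))) =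
  Iso.refl _ ≪⊗≫
    (K.wr (K.α a b c) d ≫ K.α a (K.t b c) d ≫ K.β a (K.t (K.t b c) d)) ◁ᵢ (K.π b c d a).symm ≪⊗≫
    (K.wr (K.α a b c) d ≫ K.α a (K.t b c) d) ◁ᵢ (K.βnat₂ a (K.α b c d)).symm ▷ᵢ
      (K.α b (K.t c d) a ≫ K.wl b (K.α c d a)) ≪⊗≫
    K.π a b c d ▷ᵢ (K.β a (K.t b (K.t c d)) ≫ K.α b (K.t c d) a ≫ K.wl b (K.α c d a)) ≪⊗≫
    K.α (K.t a b) c d ◁ᵢ K.R a b (K.t c d) ▷ᵢ K.wl b (K.α c d a) ≪⊗≫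
    (K.αnat₁ (K.β a b) c d).symm ▷ᵢ
      (K.α b a (K.t c d) ≫ K.wl b (K.β a (K.t c d)) ≫ K.wl b (K.α c d a)) ≪⊗≫
    K.wr (K.wr (K.β a b) c) d ◁ᵢ (K.π b a c d).symm ▷ᵢ
      (K.wl b (K.β a (K.t c d)) ≫ K.wl b (K.α c d a)) ≪⊗≫
    (K.wr (K.wr (K.β a b) c) d ≫ K.wr (K.α b a c) d ≫ K.α b (K.t a c) d) ◁ᵢ
      K.Rl b a c d ≪⊗≫
    (K.wr (K.wr (K.β a b) c) d ≫ K.wr (K.α b a c) d) ◁ᵢ (K.αnat₂ b (K.β a c) d).symm ▷ᵢ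
      (K.wl b (K.α c a d) ≫ K.wl b (K.wl c (K.β a d))) ≪⊗≫ Iso.refl _

/-- The axiom for the right 2-braid and the 2-associator: braiding `a`, `b` and `c` past `d`. -/
def BraidRight : Prop := ∀ a b c d : B,
  Iso.refl (K.wl a (K.α' b c d) ≫ K.α' a (K.t b c) d ≫ K.β (K.t a (K.t b c)) d ≫ K.α' d a (K.t b c) ≫
      K.α' (K.t d a) b c) ≪⊗≫
    K.wl a (K.α' b c d) ◁ᵢ K.S a (K.t b c) d ▷ᵢ K.α' (K.t d a) b c ≪⊗≫
    (K.wl a (K.α' b c d) ≫ K.wl a (K.β (K.t b c) d) ≫ K.α' a d (K.t b c)) ◁ᵢ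
      K.α'nat₁ (K.β a d) b c ≪⊗≫
    (K.wl a (K.α' b c d) ≫ K.wl a (K.β (K.t b c) d)) ◁ᵢ (K.π' a d b c).symm ▷ᵢ
      K.wr (K.wr (K.β a d) b) c ≪⊗≫
    K.Sl a b c d ▷ᵢ
      (K.α' a (K.t d b) c ≫ K.wr (K.α' a d b) c ≫ K.wr (K.wr (K.β a d) b) c) ≪⊗≫
    Iso.refl (K.wl a (K.wl b (K.β c d)) ≫ K.wl a (K.α' b d c) ≫ K.wl a (K.wr (K.β b d) c) ≫
      K.α' a (K.t d b) c ≫ K.wr (K.α' a d b) c ≫ K.wr (K.wr (K.β a d) b) c) =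
  Iso.refl _ ≪⊗≫
    (K.wl a (K.α' b c d) ≫ K.α' a (K.t b c) d ≫ K.β (K.t a (K.t b c)) d) ◁ᵢ (K.π' d a b c).symm ≪⊗≫
    (K.wl a (K.α' b c d) ≫ K.α' a (K.t b c) d) ◁ᵢ (K.βnat₁ (K.α' a b c) d).symm ▷ᵢ
      (K.α' d (K.t a b) c ≫ K.wr (K.α' d a b) c) ≪⊗≫
    K.π' a b c d ▷ᵢ (K.β (K.t (K.t a b) c) d ≫ K.α' d (K.t a b) c ≫ K.wr (K.α' d a b) c) ≪⊗≫
    K.α' a b (K.t c d) ◁ᵢ K.S (K.t a b) c d ▷ᵢ K.wr (K.α' d a b) c ≪⊗≫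
    (K.α'nat₃ a b (K.β c d)).symm ▷ᵢ
      (K.α' (K.t a b) d c ≫ K.wr (K.β (K.t a b) d) c ≫ K.wr (K.α' d a b) c) ≪⊗≫
    K.wl a (K.wl b (K.β c d)) ◁ᵢ (K.π' a b d c).symm ▷ᵢ
      (K.wr (K.β (K.t a b) d) c ≫ K.wr (K.α' d a b) c) ≪⊗≫
    (K.wl a (K.wl b (K.β c d)) ≫ K.wl a (K.α' b d c) ≫ K.α' a (K.t b d) c) ◁ᵢ
      K.Sr a b d c ≪⊗≫
    (K.wl a (K.wl b (K.β c d)) ≫ K.wl a (K.α' b d c)) ◁ᵢ (K.α'nat₂ a (K.β b d) c).symm ▷ᵢ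
      (K.wr (K.α' a d b) c ≫ K.wr (K.wr (K.β a d) b) c) ≪⊗≫ Iso.refl _

/-- The axiom relating the left and right 2-braids: braiding `a` and `b` past `c` and `d`. -/
def BraidMixed : Prop := ∀ a b c d : B,
  Iso.refl (K.wr (K.α' a b c) d ≫ K.α (K.t a b) c d ≫ K.β (K.t a b) (K.t c d) ≫ K.α c d (K.t a b) ≫
      K.wl c (K.α' d a b)) ≪⊗≫
    K.wr (K.α' a b c) d ◁ᵢ K.R (K.t a b) c d ▷ᵢ K.wl c (K.α' d a b) ≪⊗≫
    (K.wr (K.α' a b c) d ≫ K.wr (K.β (K.t a b) c) d) ◁ᵢ K.P₁ c a b d ▷ᵢ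
      (K.wl c (K.β (K.t a b) d) ≫ K.wl c (K.α' d a b)) ≪⊗≫
    K.Sr a b c d ▷ᵢ (K.α (K.t c a) b d ≫ K.α c a (K.t b d) ≫ K.wl c (K.α' a b d) ≫
      K.wl c (K.β (K.t a b) d) ≫ K.wl c (K.α' d a b)) ≪⊗≫
    (K.wr (K.wl a (K.β b c)) d ≫ K.wr (K.α' a c b) d ≫ K.wr (K.wr (K.β a c) b) d ≫
      K.α (K.t c a) b d ≫ K.α c a (K.t b d)) ◁ᵢ K.Sl c a b d ≪⊗≫
    (K.wr (K.wl a (K.β b c)) d ≫ K.wr (K.α' a c b) d) ◁ᵢ K.αnat₁ (K.β a c) b d ▷ᵢ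
      (K.α c a (K.t b d) ≫ K.wl c (K.wl a (K.β b d)) ≫ K.wl c (K.α' a d b) ≫
        K.wl c (K.wr (K.β a d) b)) ≪⊗≫
    (K.wr (K.wl a (K.β b c)) d ≫ K.wr (K.α' a c b) d ≫ K.α (K.t a c) b d ≫
      K.wr (K.β a c) (K.t b d)) ◁ᵢ (K.αnat₃ c a (K.β b d)).symm ▷ᵢ
      (K.wl c (K.α' a d b) ≫ K.wl c (K.wr (K.β a d) b)) ≪⊗≫
    (K.wr (K.wl a (K.β b c)) d ≫ K.wr (K.α' a c b) d ≫ K.α (K.t a c) b d) ◁ᵢ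
      K.exch (K.β a c) (K.β b d) ▷ᵢ
      (K.α c a (K.t d b) ≫ K.wl c (K.α' a d b) ≫ K.wl c (K.wr (K.β a d) b)) ≪⊗≫
    Iso.refl (K.wr (K.wl a (K.β b c)) d ≫ K.wr (K.α' a c b) d ≫ K.α (K.t a c) b d ≫
      K.wl (K.t a c) (K.β b d) ≫ K.wr (K.β a c) (K.t d b) ≫ K.α c a (K.t d b) ≫
      K.wl c (K.α' a d b) ≫ K.wl c (K.wr (K.β a d) b)) =
  Iso.refl _ ≪⊗≫
    K.P₂ a b c d ▷ᵢ (K.β (K.t a b) (K.t c d) ≫ K.α c d (K.t a b) ≫ K.wl c (K.α' d a b)) ≪⊗≫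
    (K.α a (K.t b c) d ≫ K.wl a (K.α b c d) ≫ K.α' a b (K.t c d) ≫ K.β (K.t a b) (K.t c d)) ◁ᵢ
      K.P₃ c d a b ≪⊗≫
    (K.α a (K.t b c) d ≫ K.wl a (K.α b c d)) ◁ᵢ K.S a b (K.t c d) ▷ᵢ
      (K.wr (K.α c d a) b ≫ K.α c (K.t d a) b) ≪⊗≫
    (K.α a (K.t b c) d ≫ K.wl a (K.α b c d) ≫ K.wl a (K.β b (K.t c d))) ◁ᵢ K.P₄ a c d b ▷ᵢ
      (K.wr (K.β a (K.t c d)) b ≫ K.wr (K.α c d a) b ≫ K.α c (K.t d a) b) ≪⊗≫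
    K.α a (K.t b c) d ◁ᵢ K.Rl a b c d ▷ᵢ (K.α' a c (K.t d b) ≫ K.α' (K.t a c) d b ≫
      K.wr (K.α a c d) b ≫ K.wr (K.β a (K.t c d)) b ≫ K.wr (K.α c d a) b ≫
      K.α c (K.t d a) b) ≪⊗≫
    (K.α a (K.t b c) d ≫ K.wl a (K.wr (K.β b c) d) ≫ K.wl a (K.α c b d) ≫
      K.wl a (K.wl c (K.β b d)) ≫ K.α' a c (K.t d b) ≫ K.α' (K.t a c) d b) ◁ᵢ
      K.Rr a c d b ▷ᵢ K.α c (K.t d a) b ≪⊗≫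
    (K.αnat₂ a (K.β b c) d).symm ▷ᵢ (K.wl a (K.α c b d) ≫
      K.wl a (K.wl c (K.β b d)) ≫ K.α' a c (K.t d b) ≫ K.α' (K.t a c) d b ≫
      K.wr (K.wr (K.β a c) d) b ≫ K.wr (K.α c a d) b ≫ K.wr (K.wl c (K.β a d)) b ≫
      K.α c (K.t d a) b) ≪⊗≫
    (K.wr (K.wl a (K.β b c)) d ≫ K.α a (K.t c b) d ≫ K.wl a (K.α c b d)) ◁ᵢ
      K.α'nat₃ a c (K.β b d) ▷ᵢ (K.α' (K.t a c) d b ≫ K.wr (K.wr (K.β a c) d) b ≫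
      K.wr (K.α c a d) b ≫ K.wr (K.wl c (K.β a d)) b ≫ K.α c (K.t d a) b) ≪⊗≫
    (K.wr (K.wl a (K.β b c)) d ≫ K.α a (K.t c b) d ≫ K.wl a (K.α c b d) ≫
      K.α' a c (K.t b d) ≫ K.wl (K.t a c) (K.β b d)) ◁ᵢ (K.α'nat₁ (K.β a c) d b).symm ▷ᵢ
      (K.wr (K.α c a d) b ≫ K.wr (K.wl c (K.β a d)) b ≫ K.α c (K.t d a) b) ≪⊗≫
    (K.wr (K.wl a (K.β b c)) d ≫ K.α a (K.t c b) d ≫ K.wl a (K.α c b d) ≫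
      K.α' a c (K.t b d) ≫ K.wl (K.t a c) (K.β b d) ≫ K.wr (K.β a c) (K.t d b) ≫ K.α' (K.t c a) d b ≫
      K.wr (K.α c a d) b) ◁ᵢ K.αnat₂ c (K.β a d) b ≪⊗≫
    K.wr (K.wl a (K.β b c)) d ◁ᵢ (K.P₂ a c b d).symm ▷ᵢ
      (K.wl (K.t a c) (K.β b d) ≫ K.wr (K.β a c) (K.t d b) ≫ K.α' (K.t c a) d b ≫
      K.wr (K.α c a d) b ≫ K.α c (K.t a d) b ≫ K.wl c (K.wr (K.β a d) b)) ≪⊗≫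
    (K.wr (K.wl a (K.β b c)) d ≫ K.wr (K.α' a c b) d ≫ K.α (K.t a c) b d ≫
      K.wl (K.t a c) (K.β b d) ≫ K.wr (K.β a c) (K.t d b)) ◁ᵢ (K.P₃ c a d b).symm ▷ᵢ
      K.wl c (K.wr (K.β a d) b) ≪⊗≫ Iso.refl _

/-- The Yang-Baxter axiom: the two ways of braiding `a`, `b` and `c` past each other. -/
def YangBaxter : Prop := ∀ a b c : B,
  Iso.refl (K.wr (K.β a b) c ≫ K.α b a c ≫ K.wl b (K.β a c) ≫ K.α' b c a ≫
      K.wr (K.β b c) a ≫ K.α c b a) ≪⊗≫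
    (K.R a b c).symm ▷ᵢ (K.α' b c a ≫ K.wr (K.β b c) a ≫ K.α c b a) ≪⊗≫
    (K.α a b c ≫ K.β a (K.t b c)) ◁ᵢ (K.u b c a).symm ▷ᵢ
      (K.wr (K.β b c) a ≫ K.α c b a) ≪⊗≫
    K.α a b c ◁ᵢ (K.βnat₂ a (K.β b c)).symm ▷ᵢ K.α c b a ≪⊗≫
    (K.α a b c ≫ K.wl a (K.β b c)) ◁ᵢ (K.c a c b).symm ▷ᵢ
      (K.β a (K.t c b) ≫ K.α c b a) ≪⊗≫
    (K.α a b c ≫ K.wl a (K.β b c) ≫ K.α' a c b) ◁ᵢ K.R a c b ≪⊗≫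
    Iso.refl (K.α a b c ≫ K.wl a (K.β b c) ≫ K.α' a c b ≫ K.wr (K.β a c) b ≫ K.α c a b ≫
      K.wl c (K.β a b)) =
  Iso.refl _ ≪⊗≫
    (K.wr (K.β a b) c ≫ K.α b a c) ◁ᵢ (K.S b a c).symm ▷ᵢ K.α c b a ≪⊗≫
    K.wr (K.β a b) c ◁ᵢ (K.u b a c).symm ▷ᵢ (K.β (K.t b a) c ≫ K.α' c b a ≫ K.α c b a) ≪⊗≫
    (K.wr (K.β a b) c ≫ K.β (K.t b a) c) ◁ᵢ K.c c b a ≪⊗≫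
    K.βnat₁ (K.β a b) c ≪⊗≫
    K.u a b c ▷ᵢ (K.β (K.t a b) c ≫ K.wl c (K.β a b)) ≪⊗≫
    (K.α a b c ≫ K.α' a b c ≫ K.β (K.t a b) c) ◁ᵢ (K.c c a b).symm ▷ᵢ K.wl c (K.β a b) ≪⊗≫
    K.α a b c ◁ᵢ K.S a b c ▷ᵢ (K.α c a b ≫ K.wl c (K.β a b)) ≪⊗≫ Iso.refl _

/-- The first axiom for the syllepsis: braiding `a` past `b ⊗ c` and back. -/
def SyllepsisLeft : Prop := ∀ a b c : B,
  Iso.refl (K.α a b c ≫ K.β a (K.t b c) ≫ K.α b c a ≫ K.α' b c a ≫ K.β (K.t b c) a ≫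
      K.α' a b c) ≪⊗≫
    K.R a b c ▷ᵢ (K.α' b c a ≫ K.β (K.t b c) a ≫ K.α' a b c) ≪⊗≫
    (K.wr (K.β a b) c ≫ K.α b a c ≫ K.wl b (K.β a c)) ◁ᵢ K.S b c a ≪⊗≫
    (K.wr (K.β a b) c ≫ K.α b a c) ◁ᵢ K.σl b a c ▷ᵢ
      (K.α' b a c ≫ K.wr (K.β b a) c) ≪⊗≫
    K.wr (K.β a b) c ◁ᵢ (K.u b a c).symm ▷ᵢ K.wr (K.β b a) c ≪⊗≫
    K.σr a b c ≪⊗≫ Iso.refl (𝟙 (K.t (K.t a b) c)) =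
  Iso.refl _ ≪⊗≫
    (K.α a b c ≫ K.β a (K.t b c)) ◁ᵢ (K.u b c a).symm ▷ᵢ (K.β (K.t b c) a ≫ K.α' a b c) ≪⊗≫
    K.α a b c ◁ᵢ K.σ a (K.t b c) ▷ᵢ K.α' a b c ≪⊗≫
    (K.u a b c).symm ≪⊗≫ Iso.refl _

/-- The second axiom for the syllepsis: braiding `a ⊗ b` past `c` and back. -/
def SyllepsisRight : Prop := ∀ a b c : B,
  Iso.refl (K.α' a b c ≫ K.β (K.t a b) c ≫ K.α' c a b ≫ K.α c a b ≫ K.β c (K.t a b) ≫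
      K.α a b c) ≪⊗≫
    K.S a b c ▷ᵢ (K.α c a b ≫ K.β c (K.t a b) ≫ K.α a b c) ≪⊗≫
    (K.wl a (K.β b c) ≫ K.α' a c b ≫ K.wr (K.β a c) b) ◁ᵢ K.R c a b ≪⊗≫
    (K.wl a (K.β b c) ≫ K.α' a c b) ◁ᵢ K.σr a c b ▷ᵢ
      (K.α a c b ≫ K.wl a (K.β c b)) ≪⊗≫
    K.wl a (K.β b c) ◁ᵢ K.c a c b ▷ᵢ K.wl a (K.β c b) ≪⊗≫
    K.σl a b c ≪⊗≫ Iso.refl (𝟙 (K.t a (K.t b c))) =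
  Iso.refl _ ≪⊗≫
    (K.α' a b c ≫ K.β (K.t a b) c) ◁ᵢ K.c c a b ▷ᵢ (K.β c (K.t a b) ≫ K.α a b c) ≪⊗≫
    K.α' a b c ◁ᵢ K.σ (K.t a b) c ▷ᵢ K.α a b c ≪⊗≫
    K.c a b c ≪⊗≫ Iso.refl _

/-- The symmetry axiom for the syllepsis. -/
def SyllepsisSymmetry : Prop := ∀ a b : B,
  Iso.refl (K.β a b ≫ K.β b a ≫ K.β a b) ≪⊗≫ K.σ a b ▷ᵢ K.β a b ≪⊗≫
    Iso.refl (K.β a b) =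
  Iso.refl _ ≪⊗≫ K.β a b ◁ᵢ K.σ b a ≪⊗≫ Iso.refl _

end SymmetricData

/-- A symmetric monoidal bicategory. -/
structure SymmetricMonoidalBicategory (B : Type u) [Bicategory.{w, v} B] extends
    SymmetricData B where
  associahedron : toSymmetricData.Associahedron
  unitLeft : toSymmetricData.UnitLeft
  unitRight : toSymmetricData.UnitRight
  braidLeft : toSymmetricData.BraidLeft
  braidRight : toSymmetricData.BraidRight
  braidMixed : toSymmetricData.BraidMixed
  yangBaxter : toSymmetricData.YangBaxter
  syllepsisLeft : toSymmetricData.SyllepsisLeft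
  syllepsisRight : toSymmetricData.SyllepsisRight
  syllepsisSymmetry : toSymmetricData.SyllepsisSymmetry

/-- A compact-closed bicategory: a symmetric monoidal bicategory with a choice of dual for every
object. The two isomorphisms are the zigzag identities, up to invertible 2-cells. -/
structure CompactClosedBicategory (B : Type u) [Bicategory.{w, v} B] extends
    SymmetricMonoidalBicategory B where
  dual : B → B
  coev (a : B) : unit ⟶ toSymmetricData.t a (dual a)
  ev (a : B) : toSymmetricData.t (dual a) a ⟶ unit
  zigzag (a : B) : Nonempty
    (toSymmetricData.wr (coev a) a ≫ toSymmetricData.α a (dual a) a ≫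
        toSymmetricData.wl a (ev a) ≅
      toSymmetricData.l a ≫ toSymmetricData.r' a)
  zigzag_dual (a : B) : Nonempty
    (toSymmetricData.wl (dual a) (coev a) ≫ toSymmetricData.α' (dual a) a (dual a) ≫
        toSymmetricData.wr (ev a) (dual a) ≅
      toSymmetricData.r (dual a) ≫ toSymmetricData.l' (dual a))


section Adjoints
variable {B : Type u} [Bicategory.{w, v} B]

variable (B) in
/-- A bicategory is composition-closed if it has all right extensions and all right lifts. -/
def CompositionClosed : Prop :=
  (∀ ⦃a b c : B⦄ (f : a ⟶ b) (g : a ⟶ c), ∃ t : RightExtension f g, Nonempty t.IsKan) ∧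
    ∀ ⦃a b c : B⦄ (f : b ⟶ a) (g : c ⟶ a), ∃ t : RightLift f g, Nonempty t.IsKan

/-- The 1-cell `g` is both a right and a left adjoint of `f`. -/
def IsAmbiAdjoint {a b : B} (f : a ⟶ b) (g : b ⟶ a) : Prop :=
  Nonempty (Bicategory.Adjunction f g) ∧ Nonempty (Bicategory.Adjunction g f)

variable (B) in
/-- Every 1-cell has an ambi-adjoint. It is unique up to an invertible 2-cell: see
`IsAmbiAdjoint.unique`. -/
def HasAmbiAdjoints : Prop :=
  ∀ ⦃a b : B⦄ (f : a ⟶ b), ∃ g : b ⟶ a, IsAmbiAdjoint f g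

theorem IsAmbiAdjoint.unique {a b : B} {f f' : a ⟶ b} {g g' : b ⟶ a}
    (h : IsAmbiAdjoint f g) (h' : IsAmbiAdjoint f' g') (φ : f ≅ f') : Nonempty (g ≅ g') := by
  obtain ⟨⟨k⟩, -⟩ := h
  obtain ⟨⟨k'⟩, -⟩ := h'
  exact ⟨asIso (conjugateEquiv k k' φ.inv)⟩

/-- The 2-skeleton of a bicategory: the category with the same objects, whose morphisms are the
isomorphism classes of 1-cells. -/
@[ext]
structure TwoSkeleton (B : Type u) where
  as : B

/-- Two 1-cells are equivalent if there is an invertible 2-cell between them. -/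
abbrev twoCellSetoid (a b : B) : Setoid (a ⟶ b) := isIsomorphicSetoid (a ⟶ b)

namespace TwoSkeleton

instance : Category (TwoSkeleton B) where
  Hom X Y := Quotient (twoCellSetoid X.as Y.as)
  id X := Quotient.mk _ (𝟙 X.as)
  comp := Quotient.map₂ (fun f g => f ≫ g)
    fun _ _ ⟨φ⟩ _ _ ⟨ψ⟩ => ⟨whiskerRightIso φ _ ≪≫ whiskerLeftIso _ ψ⟩
  id_comp := by rintro X Y ⟨f⟩; exact Quotient.sound ⟨λ_ f⟩
  comp_id := by rintro X Y ⟨f⟩; exact Quotient.sound ⟨ρ_ f⟩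
  assoc := by rintro W X Y Z ⟨f⟩ ⟨g⟩ ⟨h⟩; exact Quotient.sound ⟨α_ f g h⟩

/-- The isomorphism class of a 1-cell. -/
def cls {a b : B} (f : a ⟶ b) : TwoSkeleton.mk a ⟶ TwoSkeleton.mk b := Quotient.mk _ f

theorem cls_eq {a b : B} {f g : a ⟶ b} (φ : f ≅ g) : cls f = cls g := Quotient.sound ⟨φ⟩

/-- The dagger sends the class of `f` to the class of its ambi-adjoint. -/
noncomputable def dagger (h : HasAmbiAdjoints B) {X Y : TwoSkeleton B} (f : X ⟶ Y) : Y ⟶ X :=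
  Quotient.map (sa := twoCellSetoid X.as Y.as) (sb := twoCellSetoid Y.as X.as)
    (fun f => Classical.choose (h f)) (fun f f' ⟨φ⟩ =>
    (Classical.choose_spec (h f)).unique (Classical.choose_spec (h f')) φ) f

theorem dagger_cls (h : HasAmbiAdjoints B) {a b : B} {f : a ⟶ b} {g : b ⟶ a}
    (hf : IsAmbiAdjoint f g) : dagger h (cls f) = cls g :=
  Quotient.sound ((Classical.choose_spec (h f)).unique hf (Iso.refl f))

end TwoSkeleton

end Adjoints

/-- The operations of a dagger compact category. -/
structure DaggerCompactData (C : Type u) [Category.{v} C] where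
  monoidal : MonoidalCategoryStruct C
  braiding (X Y : C) : monoidal.tensorObj X Y ⟶ monoidal.tensorObj Y X
  dual : C → C
  coev (X : C) : monoidal.tensorUnit ⟶ monoidal.tensorObj X (dual X)
  ev (X : C) : monoidal.tensorObj (dual X) X ⟶ monoidal.tensorUnit
  dagger {X Y : C} (f : X ⟶ Y) : Y ⟶ X

/-- A dagger compact structure on a category: a symmetric monoidal structure, a dual for every
object, and a strict symmetric monoidal identity-on-objects involution that turns evaluation into
coevaluation. -/
structure DaggerCompactStructure (C : Type u) [Category.{v} C] where
  [monoidal : MonoidalCategory C]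
  [symmetric : SymmetricCategory C]
  [rigid : RightRigidCategory C]
  dagger {X Y : C} (f : X ⟶ Y) : Y ⟶ X
  dagger_id (X : C) : dagger (𝟙 X) = 𝟙 X
  dagger_comp {X Y Z : C} (f : X ⟶ Y) (g : Y ⟶ Z) : dagger (f ≫ g) = dagger g ≫ dagger f
  dagger_dagger {X Y : C} (f : X ⟶ Y) : dagger (dagger f) = f
  dagger_tensor {X X' Y Y' : C} (f : X ⟶ X') (g : Y ⟶ Y') :
    dagger (MonoidalCategoryStruct.tensorHom f g) =
      MonoidalCategoryStruct.tensorHom (dagger f) (dagger g)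
  dagger_associator (X Y Z : C) :
    dagger (MonoidalCategoryStruct.associator X Y Z).hom =
      (MonoidalCategoryStruct.associator X Y Z).inv
  dagger_leftUnitor (X : C) :
    dagger (MonoidalCategoryStruct.leftUnitor X).hom =
      (MonoidalCategoryStruct.leftUnitor X).inv
  dagger_rightUnitor (X : C) :
    dagger (MonoidalCategoryStruct.rightUnitor X).hom =
      (MonoidalCategoryStruct.rightUnitor X).inv
  dagger_braiding (X Y : C) :
    dagger (BraidedCategory.braiding X Y).hom = (BraidedCategory.braiding X Y).inv
  dagger_ev (X : C) :
    dagger (ExactPairing.evaluation X (HasRightDual.rightDual X)) ≫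
        (BraidedCategory.braiding (HasRightDual.rightDual X) X).hom =
      ExactPairing.coevaluation X (HasRightDual.rightDual X)

/-- The operations of a dagger compact structure. -/
def DaggerCompactStructure.data {C : Type u} [Category.{v} C] (D : DaggerCompactStructure C) :
    DaggerCompactData C :=
  letI := D.monoidal
  letI := D.symmetric
  letI := D.rigid
  { monoidal := D.monoidal.toMonoidalCategoryStruct
    braiding X Y := (BraidedCategory.braiding X Y).hom
    dual X := HasRightDual.rightDual X
    coev X := ExactPairing.coevaluation X (HasRightDual.rightDual X)
    ev X := ExactPairing.evaluation X (HasRightDual.rightDual X)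
    dagger := D.dagger }

namespace CompactClosedBicategory
variable {B : Type u} [Bicategory.{w, v} B] (K : CompactClosedBicategory B)

open TwoSkeleton

/-- The tensor product, unit, associator and unitors induced on the 2-skeleton. -/
abbrev monoidalStruct : MonoidalCategoryStruct (TwoSkeleton B) where
  tensorObj X Y := ⟨K.t X.as Y.as⟩
  whiskerLeft X _ _ := Quotient.map (fun g => K.wl X.as g) fun _ _ ⟨φ⟩ => ⟨K.wl₂ X.as φ⟩
  whiskerRight {X X'} f Y :=
    Quotient.map (sa := twoCellSetoid X.as X'.as) (sb := twoCellSetoid _ _) (fun f => K.wr f Y.as) (fun _ _ ⟨φ⟩ => ⟨K.wr₂ φ Y.as⟩) f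
  tensorHom := Quotient.map₂ (fun f g => K.ho f g) fun _ _ ⟨φ⟩ _ _ ⟨ψ⟩ => ⟨K.isoTensor φ ψ⟩
  tensorUnit := ⟨K.unit⟩
  associator X Y Z :=
    { hom := cls (K.α X.as Y.as Z.as)
      inv := cls (K.α' X.as Y.as Z.as)
      hom_inv_id := cls_eq (K.u X.as Y.as Z.as).symm
      inv_hom_id := cls_eq (K.c X.as Y.as Z.as) }
  leftUnitor X :=
    { hom := cls (K.l X.as)
      inv := cls (K.l' X.as)
      hom_inv_id := cls_eq (appIso K.leftUnitor.unit X.as).symm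
      inv_hom_id := cls_eq (appIso K.leftUnitor.counit X.as) }
  rightUnitor X :=
    { hom := cls (K.r X.as)
      inv := cls (K.r' X.as)
      hom_inv_id := cls_eq (appIso K.rightUnitor.unit X.as).symm
      inv_hom_id := cls_eq (appIso K.rightUnitor.counit X.as) }

/-- The operations induced on the 2-skeleton of a compact-closed bicategory with
ambi-adjoints. -/
noncomputable def inducedData (h : HasAmbiAdjoints B) : DaggerCompactData (TwoSkeleton B) where
  monoidal := K.monoidalStruct
  braiding X Y := cls (K.β X.as Y.as)
  dual X := ⟨K.dual X.as⟩
  coev X := cls (K.coev X.as)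
  ev X := cls (K.ev X.as)
  dagger := dagger h

end CompactClosedBicategory

/-- A finite-dimensional complex Hilbert space. -/
structure FDHilb where
  carrier : Type w
  [normed : NormedAddCommGroup carrier]
  [inner : InnerProductSpace ℂ carrier]
  [finite : FiniteDimensional ℂ carrier]

attribute [instance] FDHilb.normed FDHilb.inner FDHilb.finite

namespace FDHilb

/-- The category of finite-dimensional Hilbert spaces and linear maps. -/
instance : Category FDHilb.{w} where
  Hom X Y := X.carrier →ₗ[ℂ] Y.carrier
  id X := LinearMap.id
  comp f g := g.comp f

/-- The adjoint linear map. -/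
noncomputable def dagger {X Y : FDHilb.{w}} (f : X ⟶ Y) : Y ⟶ X :=
  LinearMap.adjoint (𝕜 := ℂ) (E := X.carrier) (F := Y.carrier) f

end FDHilb

end CompactBicat

open CompactBicat

/-! Adjoints are unique up to an invertible 2-cell, so exhibiting any one ambi-adjoint of `f`
computes the dagger of its class (`TwoSkeleton.dagger_cls`). The dagger laws therefore reduce to
closure properties of ambi-adjoint pairs. They contain the identities, compose in reversed order,
may be swapped, can be paired, and are preserved by pseudofunctors. Pairing followed by the tensor
pseudofunctor gives compatibility of the dagger with the tensor.

An equation between morphisms of the 2-skeleton asks only for an invertible 2-cell between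
representatives. The pentagon, triangle, hexagon, symmetry and zigzag laws are thus witnessed
directly by the 2-associator, the middle 2-unitor, the two 2-braids, the syllepsis and the zigzag
2-cells of the bicategory.

The decisive fact is `TwoSkeleton.dagger_iso`. An isomorphism of the 2-skeleton is represented by an
equivalence of the bicategory, and an equivalence is both left and right adjoint to its
quasi-inverse, so every isomorphism is unitary. This makes the structural isomorphisms unitary at no
cost. It also excludes `FDHilb`, where multiplication by 2 on a line is invertible but not unitary,
and a dagger-preserving equivalence would force it to be unitary. -/

namespace CompactBicat

/-! ### Closure properties of ambi-adjoint pairs. -/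

section Adjoints
variable {B : Type u} [Bicategory.{w, v} B] {C : Type u₂} [Bicategory.{w₂, v₂} C]

/-- The adjunction between pairs of 1-cells given by two adjunctions. -/
def prodAdjunction {a b : B} {c d : C} {f : a ⟶ b} {g : b ⟶ a} {f' : c ⟶ d} {g' : d ⟶ c}
    (i : Bicategory.Adjunction f g) (j : Bicategory.Adjunction f' g') :
    Bicategory.Adjunction (a := (a, c)) (b := (b, d)) (f ×ₘ f') (g ×ₘ g') where
  unit := i.unit ×ₘ j.unit
  counit := i.counit ×ₘ j.counit
  left_triangle := by
    have h₁ := i.left_triangle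
    have h₂ := j.left_triangle
    -- The zigzag is written with `⊗≫`, which hides a coherence isomorphism found by instance
    -- search. Once unfolded, everything in the product bicategory is componentwise, and the two
    -- components are the triangle identities of `i` and `j`.
    simp only [leftZigzag, bicategoricalComp, BicategoricalCoherence.iso] at h₁ h₂ ⊢
    exact Prod.ext h₁ h₂
  right_triangle := by
    have h₁ := i.right_triangle
    have h₂ := j.right_triangle
    simp only [rightZigzag, bicategoricalComp, BicategoricalCoherence.iso] at h₁ h₂ ⊢
    exact Prod.ext h₁ h₂

namespace IsAmbiAdjoint

theorem id (a : B) : IsAmbiAdjoint (𝟙 a) (𝟙 a) :=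
  ⟨⟨Bicategory.Adjunction.id a⟩, ⟨Bicategory.Adjunction.id a⟩⟩

theorem symm {a b : B} {f : a ⟶ b} {g : b ⟶ a} (h : IsAmbiAdjoint f g) : IsAmbiAdjoint g f :=
  ⟨h.2, h.1⟩

theorem comp {a b c : B} {f : a ⟶ b} {g : b ⟶ a} {f' : b ⟶ c} {g' : c ⟶ b}
    (h : IsAmbiAdjoint f g) (h' : IsAmbiAdjoint f' g') : IsAmbiAdjoint (f ≫ f') (g' ≫ g) := by
  obtain ⟨⟨i⟩, ⟨j⟩⟩ := h
  obtain ⟨⟨i'⟩, ⟨j'⟩⟩ := h'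
  exact ⟨⟨i.comp i'⟩, ⟨j'.comp j⟩⟩

/-- The tensor is a pseudofunctor on `B × B`, so a tensor of ambi-adjoints is handled by pairing
them here and then applying `map`. -/
theorem prod {a b : B} {c d : C} {f : a ⟶ b} {g : b ⟶ a} {f' : c ⟶ d} {g' : d ⟶ c}
    (h : IsAmbiAdjoint f g) (h' : IsAmbiAdjoint f' g') :
    IsAmbiAdjoint (a := (a, c)) (b := (b, d)) (f ×ₘ f') (g ×ₘ g') := by
  obtain ⟨⟨i⟩, ⟨j⟩⟩ := h
  obtain ⟨⟨i'⟩, ⟨j'⟩⟩ := h'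
  exact ⟨⟨prodAdjunction i i'⟩, ⟨prodAdjunction j j'⟩⟩

/-- Pseudofunctors preserve adjunctions, and this applies to each of the two adjunctions separately.
-/
theorem map (F : B ⥤ᵖ C) {a b : B} {f : a ⟶ b} {g : b ⟶ a} (h : IsAmbiAdjoint f g) :
    IsAmbiAdjoint (F.map f) (F.map g) := by
  obtain ⟨⟨i⟩, ⟨j⟩⟩ := h
  exact ⟨⟨F.mapAdjunction i⟩, ⟨F.mapAdjunction j⟩⟩

/-- Quasi-inverse 1-cells are ambi-adjoint. -/
theorem of_iso {a b : B} {f : a ⟶ b} {g : b ⟶ a} (η : f ≫ g ≅ 𝟙 a) (θ : g ≫ f ≅ 𝟙 b) :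
    IsAmbiAdjoint f g := by
  -- The hypotheses are symmetric in `f` and `g`, so one statement, used in both directions, gives
  -- both adjunctions.
  have key : ∀ {a b : B} {f : a ⟶ b} {g : b ⟶ a}, (f ≫ g ≅ 𝟙 a) → (g ≫ f ≅ 𝟙 b) →
      Nonempty (Bicategory.Adjunction f g) := fun η θ =>
    -- Two arbitrary invertible 2-cells need not satisfy the triangle identities. The unit is kept
    -- and the counit is corrected so that they hold; since only existence of an adjunction is
    -- claimed, losing `θ` does no harm.
    let e := Bicategory.Equivalence.mkOfAdjointifyCounit η.symm θ
    ⟨⟨e.unit.hom, e.counit.hom, e.left_triangle_hom, e.right_triangle_hom⟩⟩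
  exact ⟨key η θ, key θ η⟩

end IsAmbiAdjoint

/-! ### The dagger on the 2-skeleton. -/

namespace TwoSkeleton
variable (h : HasAmbiAdjoints B)

theorem dagger_id (X : TwoSkeleton B) : dagger h (𝟙 X) = 𝟙 X :=
  dagger_cls h (IsAmbiAdjoint.id X.as)

theorem dagger_comp {X Y Z : TwoSkeleton B} (f : X ⟶ Y) (g : Y ⟶ Z) :
    dagger h (f ≫ g) = dagger h g ≫ dagger h f := by
  obtain ⟨f⟩ := f
  obtain ⟨g⟩ := g
  exact dagger_cls h ((Classical.choose_spec (h f)).comp (Classical.choose_spec (h g)))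

/-- Here two-sidedness matters: being ambi-adjoint is a symmetric relation, whereas passing twice to
a right adjoint need not return to the starting 1-cell. -/
theorem dagger_dagger {X Y : TwoSkeleton B} (f : X ⟶ Y) : dagger h (dagger h f) = f := by
  obtain ⟨f⟩ := f
  exact dagger_cls h (Classical.choose_spec (h f)).symm

/-- Every isomorphism of the 2-skeleton is unitary. -/
theorem dagger_iso {X Y : TwoSkeleton B} (e : X ≅ Y) : dagger h e.hom = e.inv := by
  obtain ⟨f, g, hfg, hgf⟩ := e
  induction f using Quotient.inductionOn with | _ f
  induction g using Quotient.inductionOn with | _ g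
  -- Equality in the quotient lifts back to invertible 2-cells, so the representatives are
  -- quasi-inverse in the bicategory.
  obtain ⟨η⟩ := Quotient.exact hfg
  obtain ⟨θ⟩ := Quotient.exact hgf
  exact dagger_cls h (IsAmbiAdjoint.of_iso η θ)

end TwoSkeleton

end Adjoints

/-! ### The symmetric monoidal and dagger compact structure of the 2-skeleton. -/

namespace CompactClosedBicategory
variable {B : Type u} [Bicategory.{w, v} B] (K : CompactClosedBicategory B)

open TwoSkeleton

/-- The monoidal category structure on the 2-skeleton. -/
abbrev monoidalCategory : MonoidalCategory (TwoSkeleton B) :=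
  letI := K.monoidalStruct
  -- The tensor of two 1-cells is the primitive operation of a tensor pseudofunctor. The whiskerings
  -- are its values with an identity in one slot, so both comparison fields hold by `rfl`.
  MonoidalCategory.ofTensorHom
    (id_tensorHom_id := fun X Y => cls_eq (K.hoId X.as Y.as))
    (id_tensorHom := by rintro X Y Z ⟨f⟩; rfl)
    (tensorHom_id := by rintro X Y ⟨f⟩ Z; rfl)
    (tensorHom_comp_tensorHom := by
      rintro X Y Z X' Y' Z' ⟨f⟩ ⟨f'⟩ ⟨g⟩ ⟨g'⟩
      exact cls_eq (K.hoComp f g f' g').symm)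
    (associator_naturality := by
      rintro X X' X'' Y Y' Y'' ⟨f⟩ ⟨g⟩ ⟨k⟩
      exact cls_eq (K.assoc.hom.naturality (a := (X.as, X'.as, X''.as))
        (b := (Y.as, Y'.as, Y''.as)) (Prod.mkHom f (Prod.mkHom g k))))
    (leftUnitor_naturality := by
      rintro X Y ⟨f⟩
      exact cls_eq (K.leftUnitor.hom.naturality f))
    (rightUnitor_naturality := by
      rintro X Y ⟨f⟩
      exact cls_eq (K.rightUnitor.hom.naturality f))
    (pentagon := fun W X Y Z => cls_eq (K.π W.as X.as Y.as Z.as))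
    (triangle := fun X Y => cls_eq (K.mu X.as Y.as).symm)

/-- The symmetry of the 2-skeleton. -/
abbrev symmetricCategory :
    letI := K.monoidalCategory
    SymmetricCategory (TwoSkeleton B) :=
  letI := K.monoidalCategory
  { braiding := fun X Y =>
      { hom := cls (K.β X.as Y.as)
        -- The inverse is the opposite braid rather than the quasi-inverse carried by `K.braid`. The
        -- syllepsis, taken in both orders, justifies this, and the unitarity of the braid then
        -- reads as the dagger of one braid being the opposite braid.
        inv := cls (K.β Y.as X.as)
        hom_inv_id := cls_eq (K.σ X.as Y.as)
        inv_hom_id := cls_eq (K.σ Y.as X.as) }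
    braiding_naturality_right := by
      rintro X Y Z ⟨f⟩
      exact cls_eq (K.βnat₂ X.as f)
    braiding_naturality_left := by
      rintro X Y ⟨f⟩ Z
      exact cls_eq (K.βnat₁ f Z.as)
    hexagon_forward := fun X Y Z => cls_eq (K.R X.as Y.as Z.as)
    hexagon_reverse := fun X Y Z => cls_eq (K.S X.as Y.as Z.as)
    symmetry := fun X Y => cls_eq (K.σ X.as Y.as) }

/-- The duals of the 2-skeleton. -/
abbrev rightRigidCategory :
    letI := K.monoidalCategory
    RightRigidCategory (TwoSkeleton B) :=
  letI := K.monoidalCategory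
  { rightDual := fun X =>
      { rightDual := ⟨K.dual X.as⟩
        exact :=
          { coevaluation' := cls (K.coev X.as)
            evaluation' := cls (K.ev X.as)
            -- This field of `ExactPairing` is the zigzag on the dual object, and the next one is
            -- the zigzag on the object itself.
            coevaluation_evaluation' := Quotient.sound (K.zigzag_dual X.as)
            evaluation_coevaluation' := Quotient.sound (K.zigzag X.as) } } }

/-- The dagger compact structure on the 2-skeleton. -/
noncomputable def daggerCompactStructure (h : HasAmbiAdjoints B)
    (hK : ∀ a : B, IsAmbiAdjoint (K.β a (K.dual a) ≫ K.ev a) (K.coev a)) :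
    DaggerCompactStructure (TwoSkeleton B) :=
  letI := K.monoidalCategory
  letI := K.symmetricCategory
  letI := K.rightRigidCategory
  { dagger := dagger h
    dagger_id := dagger_id h
    dagger_comp := dagger_comp h
    dagger_dagger := dagger_dagger h
    dagger_tensor := by
      rintro X X' Y Y' ⟨f⟩ ⟨g⟩
      -- The tensor of the chosen ambi-adjoints is an ambi-adjoint of the tensor, being the image of
      -- a pair under `K.tensor`.
      exact dagger_cls h
        (((Classical.choose_spec (h f)).prod (Classical.choose_spec (h g))).map K.tensor)
    dagger_associator := fun X Y Z => dagger_iso h _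
    dagger_leftUnitor := fun X => dagger_iso h _
    dagger_rightUnitor := fun X => dagger_iso h _
    dagger_braiding := fun X Y => dagger_iso h _
    dagger_ev := fun X => by
      -- The hypothesis on coevaluation computes the dagger of braid followed by evaluation.
      -- Contravariance splits it into the dagger of evaluation followed by the dagger of the braid,
      -- and the latter is the opposite braid by unitarity.
      have key : dagger h (cls (K.β X.as (K.dual X.as)) ≫ cls (K.ev X.as)) = cls (K.coev X.as) :=
        dagger_cls h (hK X.as)
      rw [dagger_comp] at key
      have hβ : dagger h (cls (K.β X.as (K.dual X.as))) = cls (K.β (K.dual X.as) X.as) :=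
        dagger_iso h (BraidedCategory.braiding X ⟨K.dual X.as⟩)
      rw [hβ] at key
      exact key }

end CompactClosedBicategory

/-! ### A non-unitary isomorphism of Hilbert spaces. -/

namespace FDHilb

/-- A one-dimensional Hilbert space. -/
noncomputable def line : FDHilb.{s} := ⟨EuclideanSpace ℂ (ULift.{s} Unit)⟩

/-- Multiplication by a nonzero scalar on the one-dimensional Hilbert space. -/
noncomputable def scaleLine (z : ℂ) (hz : z ≠ 0) : line.{s} ≅ line.{s} where
  hom := (z • LinearMap.id : line.carrier →ₗ[ℂ] line.carrier)
  inv := (z⁻¹ • LinearMap.id : line.carrier →ₗ[ℂ] line.carrier)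
  hom_inv_id := LinearMap.ext fun x => inv_smul_smul₀ hz x
  inv_hom_id := LinearMap.ext fun x => smul_inv_smul₀ hz x

/-- The adjoint of a scalar is its conjugate, so a scalar is unitary exactly when it has modulus
one; 2 is self-conjugate and differs from its inverse. -/
theorem dagger_scaleLine_ne_inv :
    dagger (scaleLine.{s} 2 two_ne_zero).hom ≠ (scaleLine.{s} 2 two_ne_zero).inv := by
  intro h
  have h₁ : LinearMap.adjoint ((2 : ℂ) • LinearMap.id :
      EuclideanSpace ℂ (ULift.{s} Unit) →ₗ[ℂ] EuclideanSpace ℂ (ULift.{s} Unit)) =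
      (2 : ℂ)⁻¹ • LinearMap.id := h
  rw [map_smulₛₗ, LinearMap.adjoint_id] at h₁
  -- Evaluating at the basis vector and reading off the single coordinate turns the equation of maps
  -- into one of scalars: the conjugate of 2 equals the inverse of 2.
  have h₂ := congrArg (fun x => x.ofLp ⟨()⟩)
    (LinearMap.congr_fun h₁ (EuclideanSpace.single ⟨()⟩ 1))
  have h₃ : (starRingEnd ℂ) 2 = 2 := Complex.conj_ofNat 2
  norm_num [h₃] at h₂

end FDHilb

end CompactBicat

/-! ### The theorem. -/

theorem mainTheorem11 :
    (∀ (B : Type u) [Bicategory.{w, v} B] (K : CompactClosedBicategory B)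
      (_ : CompositionClosed B) (h : HasAmbiAdjoints B)
      (_ : ∀ a : B, IsAmbiAdjoint (K.β a (K.dual a) ≫ K.ev a) (K.coev a)),
      ∃ D : DaggerCompactStructure (TwoSkeleton B),
        D.data = K.inducedData h ∧
        ∀ (a b : B) (f : a ⟶ b) (g : b ⟶ a), IsAmbiAdjoint f g →
          D.dagger (TwoSkeleton.cls f) = TwoSkeleton.cls g) ∧
    ∀ (B : Type u) [Bicategory.{w, v} B] (_ : CompositionClosed B) (h : HasAmbiAdjoints B),
      ¬ ∃ e : CategoryTheory.Equivalence FDHilb.{s} (TwoSkeleton B),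
        ∀ (X Y : FDHilb.{s}) (f : X ⟶ Y),
          e.functor.map (FDHilb.dagger f) = TwoSkeleton.dagger h (e.functor.map f) := by
  -- The structure was assembled from the induced operations themselves, so agreement with
  -- `inducedData` is definitional.
  refine ⟨fun B _ K _ h hK => ⟨K.daggerCompactStructure h hK, rfl,
    fun a b f g hfg => TwoSkeleton.dagger_cls h hfg⟩, ?_⟩
  rintro B _ - h ⟨e, he⟩
  let i := FDHilb.scaleLine.{s} 2 two_ne_zero
  exact FDHilb.dagger_scaleLine_ne_inv
    -- The image of `i` is an isomorphism of the 2-skeleton, hence unitary. By `he` the functor then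
    -- sends the adjoint and the inverse of `i` to the same morphism, and faithfulness identifies
    -- them.
    (e.functor.map_injective ((he _ _ i.hom).trans (TwoSkeleton.dagger_iso h (e.functor.mapIso i))))
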